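/- Let $d\ge 1$ be an integer. For an algebraic integer $\alpha$ of degree $d$ (over $\mathbb{Q}$), label its Galois conjugates as $\alpha_0,\dots,\alpha_{d-1}$ so that $|\alpha_0|\ge|\alpha_1|\ge\cdots\ge|\alpha_{d-1}|$. For positive integers $k<d$, let $E_{k,d}$ be the set of all $(c_1,\dots,c_k)\in(\mathbb{R}_{\ge 0})^k$ such that $|\alpha_0||\alpha_1|^{c_1}\cdots|\alpha_k|^{c_k}\ge 1$ for every algebraic integer $\alpha$ of degree $d$. The height of a polynomial with integer coefficients is the maximum of the absolute values of its coefficients. There exists a constant $C>0$ depending only on $d$ such that the following holds. Let $k$ be a positive integer with $d>3k$, and put $$\mu=\left\lceil\frac{\lceil d/3\rceil-k}{2}\right\rceil,\qquad \mathcal{E}=\max\left\{2(d-1)(d-2),\ \frac{(d-1)(d-2)(d-3)}{2\mu}\right\}.$$ Then for every algebraic integer $\alpha$ of degree $d$ that is not a root of unity and for every $(c_1,\dots,c_k)\in E_{k,d}$, we have $$|\alpha_0||\alpha_1|^{c_1}\cdots|\alpha_k|^{c_k} > 1 + C\,H^{-\mathcal{E}+1/(k(d-1))},$$ where $H$ is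 the height of the minimal polynomial of $\alpha$. In particular, $|\alpha_0||\alpha_1|^{c_1}\cdots|\alpha_k|^{c_k}>1$. -/

import Mathlib

open Polynomial

/-- `a 0, …, a (d - 1)` is a labelling of the Galois conjugates of `α` (the complex roots of its
minimal polynomial over `ℚ`, each listed once) with `|a 0| ≥ |a 1| ≥ ⋯ ≥ |a (d - 1)|`. -/
structure IsConjugateLabelling (α : ℂ) {d : ℕ} (a : Fin d → ℂ) : Prop where
  map_eq_roots : (Finset.univ : Finset (Fin d)).val.map a = (minpoly ℚ α).aroots ℂ
  antitone_norm : Antitone fun i => ‖a i‖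

/-- The product `|a 0| |a 1| ^ c₁ ⋯ |a k| ^ c_k`; the real number `c_j` is `c ⟨j - 1, _⟩`. -/
noncomputable def weightedProduct {k d : ℕ} (hkd : k < d) (c : Fin k → ℝ) (a : Fin d → ℂ) : ℝ :=
  ‖a (Fin.castLE hkd 0)‖ * ∏ j : Fin k, ‖a (Fin.castLE hkd j.succ)‖ ^ c j

/-- The set `E_{k,d}` of all tuples `(c₁, …, c_k)` of nonnegative reals such that
`|α₀| |α₁| ^ c₁ ⋯ |α_k| ^ c_k ≥ 1` for every algebraic integer `α` of degree `d`. -/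
def exponentSet {k d : ℕ} (hkd : k < d) : Set (Fin k → ℝ) :=
  {c | (∀ j, 0 ≤ c j) ∧
    ∀ α : ℂ, IsIntegral ℤ α → (minpoly ℚ α).natDegree = d →
      ∀ a : Fin d → ℂ, IsConjugateLabelling α a → 1 ≤ weightedProduct hkd c a}

/-- The height of an integer polynomial: the maximum of the absolute values of its coefficients. -/
def polyHeight (p : ℤ[X]) : ℕ :=
  (Finset.range (p.natDegree + 1)).sup fun i => (p.coeff i).natAbs

/-- `μ = ⌈(⌈d/3⌉ - k)/2⌉`. -/
def muConst (k d : ℕ) : ℤ :=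
  ⌈((⌈(d : ℚ) / 3⌉ : ℚ) - (k : ℚ)) / 2⌉

/-- `max {2(d-1)(d-2), (d-1)(d-2)(d-3)/(2μ)}`. -/
noncomputable def mainExponent (k d : ℕ) : ℝ :=
  max (2 * ((d : ℝ) - 1) * ((d : ℝ) - 2))
    (((d : ℝ) - 1) * ((d : ℝ) - 2) * ((d : ℝ) - 3) / (2 * (muConst k d : ℝ)))

/-! Testing the definition of `exponentSet` on the conjugates of the Eisenstein trinomials
`X ^ (m + e) + 2 n X ^ e + 2`, as `n` tends to infinity, shows that the exponents `1, c₁, …, c_k`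
put at least their proportional share on the first `m` conjugates. Summation by parts then bounds
`d` times the logarithm of the weighted product below by
`∑ log |α_i| + (log |α_k| - log |α_{d-1}|)`. The first term vanishes for units and is at
least `log 2` otherwise, so the whole question is how close to each other the moduli of the `d - k`
smallest conjugates of a unit can be.

If more than two thirds of the conjugates lie on one circle `|z| = ρ`, then `ρ ^ 2` is an algebraic
integer all of whose conjugates have absolute value `ρ ^ 2`. Hence `ρ ≥ 1`, while the product of all
conjugates is `±1`, so the spread is bounded below by Northcott's and Kronecker's theorems.
Otherwise enough pairs of small conjugates have distinct moduli. As `|α_i| ^ 2` is a product of two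
conjugates, the differences `|α_i| ^ 2 - |α_j| ^ 2` occur among the algebraic integers
`α_w α_x - α_y α_z`. This family is stable under conjugation, so the product of its nonzero members
has absolute value at least `1`: many tiny members must be compensated by the others, which the
height bounds. -/

section SymmetricFunctions

variable {R S ι κ : Type*} [CommRing R] [CommRing S] [Algebra R S] [Fintype ι] [Fintype κ]
  {a : ι → S}

theorem aeval_esymm_mem_range (ha : ∏ i, (X - C (a i)) ∈ lifts (algebraMap R S)) {n : ℕ}
    (hn : n ≤ Fintype.card ι) :
    MvPolynomial.aeval a (MvPolynomial.esymm ι R n) ∈ Set.range (algebraMap R S) := by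
  have hcoeff : (∏ i, (X - C (a i))).coeff (Fintype.card ι - n) =
      (-1) ^ n * MvPolynomial.aeval a (MvPolynomial.esymm ι R n) := by
    simpa [MvPolynomial.aeval_esymm_eq_multiset_esymm, Nat.sub_sub_self hn] using
      Multiset.prod_X_sub_C_coeff (Finset.univ.val.map a)
        (Nat.sub_le (Multiset.card (Finset.univ.val.map a)) n)
  obtain ⟨r, hr⟩ := (lifts_iff_coeff_lifts _).1 ha (Fintype.card ι - n)
  exact ⟨(-1) ^ n * r, by simp [hr, hcoeff, ← mul_assoc, ← mul_pow]⟩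

theorem aeval_mem_range_of_isSymmetric (ha : ∏ i, (X - C (a i)) ∈ lifts (algebraMap R S))
    {Q : MvPolynomial ι R} (hQ : Q.IsSymmetric) :
    MvPolynomial.aeval a Q ∈ Set.range (algebraMap R S) := by
  obtain ⟨P, hP⟩ := MvPolynomial.esymmAlgHom_surjective R (le_refl (Fintype.card ι)) ⟨Q, hQ⟩
  obtain rfl : MvPolynomial.aeval (fun i : Fin (Fintype.card ι) =>
      MvPolynomial.esymm ι R (i + 1)) P = Q := by
    rw [← MvPolynomial.esymmAlgHom_apply, hP]
  have hrange : (MvPolynomial.aeval (R := R) fun i : Fin (Fintype.card ι) =>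
      MvPolynomial.aeval a (MvPolynomial.esymm ι R (i + 1))).range ≤ ⊥ := by
    rw [MvPolynomial.aeval_range, Algebra.adjoin_le_iff]
    rintro _ ⟨i, rfl⟩
    exact Algebra.mem_bot.2 (aeval_esymm_mem_range ha i.2)
  rw [MvPolynomial.comp_aeval_apply]
  exact Algebra.mem_bot.1 (hrange ⟨P, rfl⟩)

theorem prod_X_sub_C_aeval_mem_lifts (ha : ∏ i, (X - C (a i)) ∈ lifts (algebraMap R S))
    (F : κ → MvPolynomial ι R)
    (hF : ∀ e : Equiv.Perm ι, ∃ e' : Equiv.Perm κ, ∀ t, MvPolynomial.rename e (F t) = F (e' t)) :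
    ∏ t, (X - C (MvPolynomial.aeval a (F t))) ∈ lifts (algebraMap R S) := by
  refine (lifts_iff_coeff_lifts _).2 fun n => ?_
  have hmap : ∏ t, (X - C (MvPolynomial.aeval a (F t))) =
      (∏ t, (X - C (F t))).map (MvPolynomial.aeval a : _ →ₐ[R] S).toRingHom := by
    simp [Polynomial.map_prod]
  rw [hmap, coeff_map]
  refine aeval_mem_range_of_isSymmetric ha fun e => ?_
  obtain ⟨e', he'⟩ := hF e
  have hren : (∏ t, (X - C (F t))).map (MvPolynomial.rename e : _ →ₐ[R] _).toRingHom =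
      ∏ t, (X - C (F t)) := by
    simpa [Polynomial.map_prod, he'] using Equiv.prod_comp e' fun t => X - C (F t)
  conv_rhs => rw [← hren, coeff_map]
  rfl

end SymmetricFunctions

section IntegralFamilies

variable {ι κ : Type*} [Fintype ι] [Fintype κ]

theorem norm_trailingCoeff_prod_X_sub_C (f : κ → ℂ) :
    ‖(∏ t, (X - C (f t))).trailingCoeff‖ = ∏ t with f t ≠ 0, ‖f t‖ := by
  classical
  have hlinear (z : ℂ) : ‖(X - C z).trailingCoeff‖ = if z ≠ 0 then ‖z‖ else 1 := by
    split_ifs with hz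
    · rw [trailingCoeff_eq_coeff_zero (by simpa using hz)]
      simp
    · obtain rfl : z = 0 := not_not.1 hz
      simp [trailingCoeff]
  have hprod (s : Finset κ) :
      ‖(∏ t ∈ s, (X - C (f t))).trailingCoeff‖ = ∏ t ∈ s, ‖(X - C (f t)).trailingCoeff‖ := by
    induction s using Finset.induction_on with
    | empty => simp [trailingCoeff]
    | insert t s ht ih =>
      rw [Finset.prod_insert ht, Finset.prod_insert ht, trailingCoeff_mul, norm_mul, ih]
  rw [hprod, Finset.prod_filter]
  exact Finset.prod_congr rfl fun t _ => hlinear (f t)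

theorem one_le_prod_norm_of_mem_lifts {f : κ → ℂ}
    (hf : ∏ t, (X - C (f t)) ∈ lifts (algebraMap ℤ ℂ)) :
    1 ≤ ∏ t with f t ≠ 0, ‖f t‖ := by
  obtain ⟨n, hn⟩ := (lifts_iff_coeff_lifts _).1 hf (∏ t, (X - C (f t))).natTrailingDegree
  rw [← norm_trailingCoeff_prod_X_sub_C, trailingCoeff, ← hn, algebraMap_int_eq, eq_intCast,
    Complex.norm_intCast]
  have hn0 : n ≠ 0 := by
    rintro rfl
    rw [map_zero] at hn
    exact Finset.prod_ne_zero_iff.2 (fun t _ => X_sub_C_ne_zero (f t))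
      (trailingCoeff_eq_zero.1 hn.symm)
  exact_mod_cast Int.one_le_abs hn0

theorem rootMultiplicity_map_eq_of_isConjRoot {K L : Type*} [Field K] [Field L] [CharZero L]
    [Algebra K L] {x y : L} (h : IsConjRoot K x y) (q : K[X]) :
    (q.map (algebraMap K L)).rootMultiplicity x = (q.map (algebraMap K L)).rootMultiplicity y := by
  rcases eq_or_ne q 0 with rfl | hq
  · simp
  have hqL : q.map (algebraMap K L) ≠ 0 :=
    (Polynomial.map_ne_zero_iff (algebraMap K L).injective).2 hq
  have hroot (p : K[X]) :
      (p.map (algebraMap K L)).IsRoot x ↔ (p.map (algebraMap K L)).IsRoot y := by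
    simp only [IsRoot.def, eval_map_algebraMap, ← minpoly.dvd_iff, isConjRoot_def.1 h]
  refine eq_of_forall_lt_iff fun n => ?_
  simp only [lt_rootMultiplicity_iff_isRoot_iterate_derivative hqL, iterate_derivative_map, hroot]

theorem one_le_of_forall_isConjRoot_norm_eq {x : ℂ} (hx : IsIntegral ℤ x) (h0 : x ≠ 0) {r : ℝ}
    (hr : ∀ y : ℂ, IsConjRoot ℚ x y → ‖y‖ = r) : 1 ≤ r := by
  by_contra! hlt
  have hmahler : ((minpoly ℤ x).map (Int.castRingHom ℂ)).mahlerMeasure = 1 := by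
    rw [mahlerMeasure_eq_leadingCoeff_mul_prod_roots, ((minpoly.monic hx).map _).leadingCoeff,
      norm_one, one_mul]
    refine Multiset.prod_eq_one fun s hs => ?_
    obtain ⟨y, hy, rfl⟩ := Multiset.mem_map.1 hs
    refine max_eq_left ((hr y (isConjRoot_of_aeval_eq_zero hx.tower_top ?_)).trans_lt hlt).le
    rw [minpoly.isIntegrallyClosed_eq_field_fractions' ℚ hx, aeval_map_algebraMap]
    simpa [aeval_def, eval₂_eq_eval_map] using isRoot_of_mem_roots hy
  obtain ⟨n, hn, hxn⟩ := pow_eq_one_of_mahlerMeasure_eq_one hmahler h0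
    (mem_aroots.2 ⟨(minpoly.monic hx).ne_zero, minpoly.aeval ℤ x⟩)
  have hx1 : ‖x‖ = 1 := (isOfFinOrder_iff_pow_eq_one.2 ⟨n, hn, hxn⟩).norm_eq_one
  exact hlt.ne (hr x .refl ▸ hx1)

variable {a : ι → ℂ}

theorem isIntegral_of_mem_lifts (ha : ∏ i, (X - C (a i)) ∈ lifts (algebraMap ℤ ℂ)) (i : ι) :
    IsIntegral ℤ (a i) := by
  obtain ⟨q, hq⟩ := ha
  have hq' : q.map (algebraMap ℤ ℂ) = ∏ i, (X - C (a i)) := hq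
  refine ⟨q, monic_of_injective (algebraMap ℤ ℂ).injective_int (hq' ▸ monic_prod_X_sub_C a _), ?_⟩
  rw [eval₂_eq_eval_map, hq', eval_prod]
  exact Finset.prod_eq_zero (Finset.mem_univ i) (by simp)

theorem exists_perm_conj_of_mem_lifts (ha : ∏ i, (X - C (a i)) ∈ lifts (algebraMap ℤ ℂ))
    (hinj : Function.Injective a) :
    ∃ τ : Equiv.Perm ι, ∀ i, a (τ i) = starRingEnd ℂ (a i) := by
  obtain ⟨q, hq⟩ := ha
  have hroot (z : ℂ) : aeval z q = 0 ↔ ∃ i, a i = z := by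
    have hq' : q.map (algebraMap ℤ ℂ) = ∏ i, (X - C (a i)) := hq
    rw [← eval_map_algebraMap, hq', eval_prod, Finset.prod_eq_zero_iff]
    simp [sub_eq_zero, eq_comm]
  have hex (i : ι) : ∃ j, a j = starRingEnd ℂ (a i) := by
    rw [← hroot]
    have := aeval_algHom_apply ((starRingEnd ℂ).toIntAlgHom) (a i) q
    rw [(hroot _).2 ⟨i, rfl⟩, map_zero] at this
    exact this
  choose f hf using hex
  have hf_inj : Function.Injective f := fun i j hij =>
    hinj ((starRingEnd ℂ).injective (by rw [← hf, ← hf, hij]))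
  exact ⟨Equiv.ofBijective f (Finite.injective_iff_bijective.1 hf_inj), hf⟩

theorem card_filter_eq_of_isConjRoot [DecidableEq ℂ] {f : κ → ℂ}
    (hf : ∏ t, (X - C (f t)) ∈ lifts (algebraMap ℤ ℂ)) {z w : ℂ} (h : IsConjRoot ℚ z w) :
    Finset.card {t | f t = z} = Finset.card {t | f t = w} := by
  have hcount (z : ℂ) :
      Finset.card {t | f t = z} = (∏ t, (X - C (f t))).rootMultiplicity z := by
    have hroots := roots_multiset_prod_X_sub_C (Finset.univ.val.map f)
    rw [Multiset.map_map] at hroots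
    rw [← count_roots, Finset.prod_eq_multiset_prod]
    refine .trans ?_ (congrArg (Multiset.count z) hroots.symm)
    simp [Multiset.count_map, eq_comm, Finset.card_def]
  obtain ⟨q, hq⟩ := hf
  have hq' : ∏ t, (X - C (f t)) = (q.map (algebraMap ℤ ℚ)).map (algebraMap ℚ ℂ) := by
    rw [Polynomial.map_map, ← IsScalarTower.algebraMap_eq]
    exact hq.symm
  rw [hcount, hcount, hq']
  exact rootMultiplicity_map_eq_of_isConjRoot h _

theorem prod_X_sub_C_mul_mem_lifts (ha : ∏ i, (X - C (a i)) ∈ lifts (algebraMap ℤ ℂ)) :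
    ∏ t : ι × ι, (X - C (a t.1 * a t.2)) ∈ lifts (algebraMap ℤ ℂ) := by
  have := prod_X_sub_C_aeval_mem_lifts ha
    (fun t : ι × ι => MvPolynomial.X t.1 * MvPolynomial.X t.2)
    fun e => ⟨e.prodCongr e, fun t => by simp⟩
  simpa only [map_mul, MvPolynomial.aeval_X] using this

theorem norm_eq_sq_of_lt_card_filter_mul_eq (hinj : Function.Injective a) (h0 : ∀ i, a i ≠ 0)
    {ρ : ℝ} {v : ℂ} (hv : 2 * Finset.card {i | ‖a i‖ ≠ ρ} <
      Finset.card {t : ι × ι | a t.1 * a t.2 = v}) : ‖v‖ = ρ ^ 2 := by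
  classical
  set P : Finset (ι × ι) := {t | a t.1 * a t.2 = v}
  have hP {t : ι × ι} (ht : t ∈ P) : a t.1 * a t.2 = v := (Finset.mem_filter.1 ht).2
  have hfst : Set.InjOn Prod.fst (P : Set (ι × ι)) := fun s hs t ht hst => by
    refine Prod.ext hst (hinj (mul_left_cancel₀ (h0 s.1) ?_))
    rw [hP hs, hst, hP ht]
  have hsnd : Set.InjOn Prod.snd (P : Set (ι × ι)) := fun s hs t ht hst => by
    refine Prod.ext (hinj (mul_right_cancel₀ (h0 s.2) ?_)) hst
    rw [hP hs, hst, hP ht]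
  have hcard (g : ι × ι → ι) (hg : Set.InjOn g (P : Set (ι × ι))) :
      Finset.card {t ∈ P | ‖a (g t)‖ ≠ ρ} ≤ Finset.card {i | ‖a i‖ ≠ ρ} :=
    Finset.card_le_card_of_injOn g (fun t ht => by simpa using (Finset.mem_filter.1 ht).2)
      (hg.mono (Finset.filter_subset _ _))
  obtain ⟨t, ht, ht'⟩ : ∃ t ∈ P, t ∉ {t ∈ P | ‖a t.1‖ ≠ ρ} ∪ {t ∈ P | ‖a t.2‖ ≠ ρ} := by
    refine Finset.exists_mem_notMem_of_card_lt_card ((Finset.card_union_le _ _).trans_lt ?_)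
    have := hcard _ hfst
    have := hcard _ hsnd
    omega
  simp only [Finset.mem_union, Finset.mem_filter, ht, true_and, not_or, not_not] at ht'
  rw [← hP ht, norm_mul, ht'.1, ht'.2, sq]

theorem one_le_of_card_filter_norm_eq (ha : ∏ i, (X - C (a i)) ∈ lifts (algebraMap ℤ ℂ))
    (hinj : Function.Injective a) (h0 : ∀ i, a i ≠ 0) {ρ : ℝ}
    (hρ : 2 * Fintype.card ι < 3 * Finset.card {i | ‖a i‖ = ρ}) : 1 ≤ ρ := by
  classical
  obtain ⟨τ, hτ⟩ := exists_perm_conj_of_mem_lifts ha hinj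
  have hmul {i : ι} (hi : ‖a i‖ = ρ) : a i * a (τ i) = (ρ ^ 2 : ℝ) := by
    rw [hτ, Complex.mul_conj, Complex.normSq_eq_norm_sq, hi]
  have hpopular : Finset.card {i | ‖a i‖ = ρ} ≤
      Finset.card {t : ι × ι | a t.1 * a t.2 = (ρ ^ 2 : ℝ)} :=
    Finset.card_le_card_of_injOn (fun i => (i, τ i))
      (fun i hi => by simpa using hmul (Finset.mem_filter.1 hi).2)
      fun i _ j _ hij => congrArg Prod.fst hij
  have hcompl : Finset.card {i | ‖a i‖ = ρ} + Finset.card {i | ‖a i‖ ≠ ρ} = Fintype.card ι :=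
    Finset.card_filter_add_card_filter_not _
  obtain ⟨i, hi⟩ : ∃ i, ‖a i‖ = ρ := by
    obtain ⟨i, hi⟩ := Finset.card_pos.1 (show 0 < Finset.card {i | ‖a i‖ = ρ} by omega)
    exact ⟨i, (Finset.mem_filter.1 hi).2⟩
  have hint : IsIntegral ℤ (((ρ ^ 2 : ℝ)) : ℂ) := by
    rw [← hmul hi]
    exact (isIntegral_of_mem_lifts ha i).mul (isIntegral_of_mem_lifts ha (τ i))
  have hsq := one_le_of_forall_isConjRoot_norm_eq hint
    (hmul hi ▸ mul_ne_zero (h0 _) (h0 _)) fun v hv =>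
    norm_eq_sq_of_lt_card_filter_mul_eq hinj h0 (ρ := ρ) <| by
      rw [← card_filter_eq_of_isConjRoot (prod_X_sub_C_mul_mem_lifts ha) hv]
      omega
  exact (one_le_sq_iff₀ (hi ▸ norm_nonneg _)).1 hsq

end IntegralFamilies

theorem natDegree_minpoly_int {α : ℂ} (hα : IsIntegral ℤ α) :
    (minpoly ℤ α).natDegree = (minpoly ℚ α).natDegree := by
  rw [minpoly.isIntegrallyClosed_eq_field_fractions' ℚ hα, (minpoly.monic hα).natDegree_map]

theorem natAbs_coeff_le_polyHeight (p : ℤ[X]) (i : ℕ) : (p.coeff i).natAbs ≤ polyHeight p := by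
  rcases le_or_gt i p.natDegree with hi | hi
  · exact Finset.le_sup (f := fun i => (p.coeff i).natAbs) (Finset.mem_range_succ_iff.2 hi)
  · simp [coeff_eq_zero_of_natDegree_lt hi]

theorem one_le_polyHeight_of_monic {p : ℤ[X]} (hp : p.Monic) : 1 ≤ polyHeight p := by
  simpa [hp.coeff_natDegree] using natAbs_coeff_le_polyHeight p p.natDegree

theorem supNorm_map_le_polyHeight (p : ℤ[X]) :
    (p.map (Int.castRingHom ℂ)).supNorm ≤ polyHeight p := by
  obtain ⟨i, hi⟩ := (p.map (Int.castRingHom ℂ)).exists_eq_supNorm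
  rw [hi, coeff_map, eq_intCast, Complex.norm_intCast, ← Int.cast_abs, Int.abs_eq_natAbs]
  exact_mod_cast natAbs_coeff_le_polyHeight p i

theorem exists_isConjugateLabelling {α : ℂ} {d : ℕ} (hd : (minpoly ℚ α).natDegree = d) :
    ∃ a : Fin d → ℂ, IsConjugateLabelling α a := by
  have hlength : ((minpoly ℚ α).aroots ℂ).toList.length = d := by
    rw [Multiset.length_toList, aroots_def, IsAlgClosed.card_roots_eq_natDegree, natDegree_map, hd]
  subst hlength
  set l := ((minpoly ℚ α).aroots ℂ).toList with hl
  let σ := Tuple.sort fun i => -‖l.get i‖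
  refine ⟨fun i => l.get (σ i), ?_, fun i j hij => ?_⟩
  · have hperm : Finset.univ.val.map (fun i => l.get (σ i)) = Finset.univ.val.map l.get := by
      conv_rhs => rw [← Multiset.map_univ_val_equiv σ, Multiset.map_map]
      rfl
    rw [hperm, Fin.univ_val_map, List.ofFn_get, hl, Multiset.coe_toList]
  · exact neg_le_neg_iff.1 (Tuple.monotone_sort (fun i => -‖l.get i‖) hij)

namespace IsConjugateLabelling

variable {α : ℂ} {d : ℕ} {a : Fin d → ℂ}

theorem injective (h : IsConjugateLabelling α a) (hα : IsIntegral ℤ α) : Function.Injective a := by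
  have hnodup : ((Finset.univ : Finset (Fin d)).val.map a).Nodup :=
    h.map_eq_roots ▸ nodup_roots (minpoly.irreducible hα.tower_top).separable.map
  exact fun i j => Multiset.inj_on_of_nodup_map hnodup i (Finset.mem_univ i) j (Finset.mem_univ j)

theorem map_minpoly (h : IsConjugateLabelling α a) (hα : IsIntegral ℤ α) :
    (minpoly ℤ α).map (algebraMap ℤ ℂ) = ∏ i, (X - C (a i)) := by
  have hmonic : ((minpoly ℚ α).map (algebraMap ℚ ℂ)).Monic := (minpoly.monic hα.tower_top).map _
  rw [IsScalarTower.algebraMap_eq ℤ ℚ ℂ, ← Polynomial.map_map,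
    ← minpoly.isIntegrallyClosed_eq_field_fractions' ℚ hα,
    (IsAlgClosed.splits _).eq_prod_roots_of_monic hmonic, ← aroots_def, ← h.map_eq_roots,
    Multiset.map_map]
  rfl

theorem prod_X_sub_C_mem_lifts (h : IsConjugateLabelling α a) (hα : IsIntegral ℤ α) :
    ∏ i, (X - C (a i)) ∈ lifts (algebraMap ℤ ℂ) :=
  ⟨minpoly ℤ α, h.map_minpoly hα⟩

theorem aeval_minpoly_eq_zero (h : IsConjugateLabelling α a) (hα : IsIntegral ℤ α) (i : Fin d) :
    aeval (a i) (minpoly ℤ α) = 0 := by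
  rw [← eval_map_algebraMap, h.map_minpoly hα, eval_prod]
  exact Finset.prod_eq_zero (Finset.mem_univ i) (by simp)

theorem prod_norm (h : IsConjugateLabelling α a) (hα : IsIntegral ℤ α) :
    ∏ i, ‖a i‖ = |((minpoly ℤ α).coeff 0 : ℝ)| := by
  have heval := congrArg (fun p => ‖p.eval 0‖) (h.map_minpoly hα)
  simpa [eval_prod, ← coeff_zero_eq_eval_zero] using heval.symm

theorem prod_norm_ne_zero (h : IsConjugateLabelling α a) (hα : IsIntegral ℤ α) (h0 : α ≠ 0) :
    ∏ i, ‖a i‖ ≠ 0 := by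
  have hcoeff := minpoly.coeff_zero_ne_zero (A := ℚ) hα.tower_top h0
  rw [minpoly.isIntegrallyClosed_eq_field_fractions' ℚ hα, coeff_map, algebraMap_int_eq,
    eq_intCast, Int.cast_ne_zero] at hcoeff
  rw [h.prod_norm hα, abs_ne_zero, Int.cast_ne_zero]
  exact hcoeff

theorem ne_zero (h : IsConjugateLabelling α a) (hα : IsIntegral ℤ α) (h0 : α ≠ 0) (i : Fin d) :
    a i ≠ 0 :=
  norm_ne_zero_iff.1 (Finset.prod_ne_zero_iff.1 (h.prod_norm_ne_zero hα h0) i (Finset.mem_univ i))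

theorem sum_log_norm_eq_zero_or_log_two_le (h : IsConjugateLabelling α a) (hα : IsIntegral ℤ α)
    (h0 : α ≠ 0) :
    ∑ i, Real.log ‖a i‖ = 0 ∨ Real.log 2 ≤ ∑ i, Real.log ‖a i‖ := by
  have hprod := h.prod_norm_ne_zero hα h0
  rw [← Real.log_prod (Finset.prod_ne_zero_iff.1 hprod), h.prod_norm hα]
  rw [h.prod_norm hα, abs_ne_zero, Int.cast_ne_zero] at hprod
  rcases (Int.one_le_abs hprod).eq_or_lt with hone | htwo
  · left
    rw [← Int.cast_abs, ← hone, Int.cast_one, Real.log_one]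
  · right
    exact Real.log_le_log two_pos (by exact_mod_cast htwo)

theorem mahlerMeasure_eq (h : IsConjugateLabelling α a) (hα : IsIntegral ℤ α) :
    ((minpoly ℤ α).map (Int.castRingHom ℂ)).mahlerMeasure = ∏ i, max 1 ‖a i‖ := by
  rw [mahlerMeasure_eq_leadingCoeff_mul_prod_roots, ((minpoly.monic hα).map _).leadingCoeff,
    ← algebraMap_int_eq, h.map_minpoly hα,
    roots_prod _ _ (Finset.prod_ne_zero_iff.2 fun i _ => X_sub_C_ne_zero _)]
  simp [List.prod_ofFn]

theorem log_mahlerMeasure_eq (h : IsConjugateLabelling α a) (hα : IsIntegral ℤ α) :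
    Real.log ((minpoly ℤ α).map (Int.castRingHom ℂ)).mahlerMeasure
      = ∑ i, Real.posLog ‖a i‖ := by
  rw [h.mahlerMeasure_eq hα, Real.log_prod fun i _ => by positivity]
  exact Finset.sum_congr rfl fun i _ => (Real.posLog_eq_log_max_one (norm_nonneg _)).symm

theorem sum_posLog_le_log_polyHeight (h : IsConjugateLabelling α a) (hα : IsIntegral ℤ α)
    (hd : (minpoly ℚ α).natDegree = d) :
    ∑ i, Real.posLog ‖a i‖ ≤ Real.log (polyHeight (minpoly ℤ α)) + Real.log √(d + 1) := by
  have hdeg : ((minpoly ℤ α).map (Int.castRingHom ℂ)).natDegree = d := by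
    rw [(minpoly.monic hα).natDegree_map, natDegree_minpoly_int hα, hd]
  have hH : (1 : ℝ) ≤ polyHeight (minpoly ℤ α) :=
    mod_cast one_le_polyHeight_of_monic (minpoly.monic hα)
  rw [← h.log_mahlerMeasure_eq hα, ← Real.log_mul (by positivity) (by positivity)]
  refine Real.log_le_log (by rw [h.mahlerMeasure_eq hα]; positivity) ?_
  refine (mahlerMeasure_le_sqrt_natDegree_add_one_mul_supNorm _).trans ?_
  rw [hdeg, mul_comm]
  gcongr
  exact supNorm_map_le_polyHeight _

end IsConjugateLabelling

-- By Northcott only finitely many Mahler measures lie below `2`; Kronecker excludes the value `1`.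
theorem exists_pos_le_sum_posLog_norm (d : ℕ) :
    ∃ δ : ℝ, 0 < δ ∧ ∀ α : ℂ, IsIntegral ℤ α → α ≠ 0 → (minpoly ℚ α).natDegree = d →
      (∀ n : ℕ, 0 < n → α ^ n ≠ 1) →
      ∀ a : Fin d → ℂ, IsConjugateLabelling α a → δ ≤ ∑ i, Real.posLog ‖a i‖ := by
  let M (p : ℤ[X]) : ℝ := (p.map (Int.castRingHom ℂ)).mahlerMeasure
  have hfinite : (insert 2 (M '' {p | p.natDegree ≤ d ∧ M p ≤ 2}) ∩ Set.Ioi 1).Finite :=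
    (((finite_mahlerMeasure_le d 2).image M).insert 2).inter_of_left _
  obtain ⟨m, ⟨-, hm⟩, hmin⟩ := Set.exists_min_image _ id hfinite ⟨2, by simp⟩
  refine ⟨Real.log m, Real.log_pos hm, fun α hα h0 hd hroot a h => ?_⟩
  rw [← h.log_mahlerMeasure_eq hα]
  refine Real.log_le_log (one_pos.trans hm) ?_
  have hne : 1 ≠ M (minpoly ℤ α) := fun hone => by
    obtain ⟨n, hn, hαn⟩ := pow_eq_one_of_mahlerMeasure_eq_one hone.symm h0
      (mem_aroots.2 ⟨(minpoly.monic hα).ne_zero, minpoly.aeval ℤ α⟩)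
    exact hroot n hn hαn
  have hlt : 1 < M (minpoly ℤ α) :=
    (one_le_mahlerMeasure_of_ne_zero (minpoly.monic hα).ne_zero).lt_of_ne hne
  rcases le_or_gt (M (minpoly ℤ α)) 2 with hle | hgt
  · refine hmin _ ⟨.inr ⟨minpoly ℤ α, ⟨?_, hle⟩, rfl⟩, hlt⟩
    rw [natDegree_minpoly_int hα, hd]
  · exact (hmin 2 ⟨.inl rfl, one_lt_two (α := ℝ)⟩).trans hgt.le

section Liouville

variable {ι κ : Type*} [Fintype ι] [Fintype κ]

theorem card_mul_sum_apply_embedding {R : Type*} [CommSemiring R] (j : κ) (f : ι → R) :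
    Fintype.card ι * ∑ t : κ ↪ ι, f (t j) = Fintype.card (κ ↪ ι) * ∑ x, f x := by
  classical
  have hfiber (x y : ι) :
      Finset.card {t : κ ↪ ι | t j = x} = Finset.card {t : κ ↪ ι | t j = y} :=
    Finset.card_equiv (Equiv.embeddingCongr (Equiv.refl κ) (Equiv.swap x y)) fun t => by
      simp [Equiv.swap_apply_eq_iff]
  have hcard (y : ι) :
      Fintype.card (κ ↪ ι) = Fintype.card ι * Finset.card {t : κ ↪ ι | t j = y} := by
    rw [← Finset.card_univ, Finset.card_eq_sum_card_fiberwise (f := fun t : κ ↪ ι => t j)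
      (t := Finset.univ) (fun _ _ => Finset.mem_univ _), Finset.sum_congr rfl fun x _ => hfiber x y,
      Finset.sum_const, smul_eq_mul, Finset.card_univ]
  rw [← Finset.sum_fiberwise' Finset.univ (fun t : κ ↪ ι => t j) f, Finset.mul_sum, Finset.mul_sum]
  refine Finset.sum_congr rfl fun y _ => ?_
  rw [hcard y, Finset.sum_const, nsmul_eq_mul, Nat.cast_mul, mul_assoc]

theorem log_norm_mul_sub_mul_le (x y z w : ℂ) :
    Real.log ‖x * y - z * w‖ ≤ Real.log 2 +
      (Real.posLog ‖x‖ + Real.posLog ‖y‖ + Real.posLog ‖z‖ + Real.posLog ‖w‖) := by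
  have hsub : Real.posLog ‖x * y - z * w‖ ≤ Real.posLog (‖x * y‖ + ‖z * w‖) :=
    Real.posLog_le_posLog (norm_nonneg _) (norm_sub_le _ _)
  have hadd := Real.posLog_add (x := ‖x * y‖) (y := ‖z * w‖)
  have hxy : Real.posLog ‖x * y‖ ≤ _ := norm_mul x y ▸ Real.posLog_mul
  have hzw : Real.posLog ‖z * w‖ ≤ _ := norm_mul z w ▸ Real.posLog_mul
  have hle : Real.log ‖x * y - z * w‖ ≤ Real.posLog ‖x * y - z * w‖ := le_max_right _ _
  linarith

theorem sum_log_nonneg_of_mem_lifts {f : κ → ℂ}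
    (hf : ∏ t, (X - C (f t)) ∈ lifts (algebraMap ℤ ℂ)) : 0 ≤ ∑ t, Real.log ‖f t‖ := by
  have hlog := Real.log_nonneg (one_le_prod_norm_of_mem_lifts hf)
  rw [Real.log_prod fun t ht => norm_ne_zero_iff.2 (Finset.mem_filter.1 ht).2] at hlog
  refine hlog.trans_eq (Finset.sum_filter_of_ne fun t _ ht h0 => ht ?_)
  rw [h0, norm_zero, Real.log_zero]

theorem prod_X_sub_C_mul_sub_mul_mem_lifts {a : ι → ℂ}
    (ha : ∏ i, (X - C (a i)) ∈ lifts (algebraMap ℤ ℂ)) (s : Fin 4 → κ) :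
    ∏ t : κ ↪ ι, (X - C (a (t (s 0)) * a (t (s 1)) - a (t (s 2)) * a (t (s 3)))) ∈
      lifts (algebraMap ℤ ℂ) := by
  have := prod_X_sub_C_aeval_mem_lifts ha
    (fun t : κ ↪ ι => MvPolynomial.X (t (s 0)) * MvPolynomial.X (t (s 1)) -
      MvPolynomial.X (t (s 2)) * MvPolynomial.X (t (s 3)))
    fun e => ⟨Equiv.embeddingCongr (Equiv.refl κ) e, fun t => by simp⟩
  simpa only [map_sub, map_mul, MvPolynomial.aeval_X] using this

theorem card_mul_neg_log_le {a : ι → ℂ}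
    (ha : ∏ i, (X - C (a i)) ∈ lifts (algebraMap ℤ ℂ)) (s : Fin 4 → κ) {T : Finset (κ ↪ ι)} {ε : ℝ}
    (hne : ∀ t ∈ T, a (t (s 0)) * a (t (s 1)) ≠ a (t (s 2)) * a (t (s 3)))
    (hle : ∀ t ∈ T, ‖a (t (s 0)) * a (t (s 1)) - a (t (s 2)) * a (t (s 3))‖ ≤ ε) :
    Fintype.card ι * (T.card * -Real.log ε) ≤
      Fintype.card (κ ↪ ι) * (Fintype.card ι * Real.log 2 + 4 * ∑ i, Real.posLog ‖a i‖) := by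
  let u (t : κ ↪ ι) : ℝ := Real.log 2 + (Real.posLog ‖a (t (s 0))‖ + Real.posLog ‖a (t (s 1))‖ +
    Real.posLog ‖a (t (s 2))‖ + Real.posLog ‖a (t (s 3))‖)
  have hu (t : κ ↪ ι) : 0 ≤ u t := by
    have hpos (j : Fin 4) := Real.posLog_nonneg (x := ‖a (t (s j))‖)
    linarith [hpos 0, hpos 1, hpos 2, hpos 3, Real.log_pos one_lt_two]
  have hsum : Fintype.card ι * ∑ t, u t =
      Fintype.card (κ ↪ ι) * (Fintype.card ι * Real.log 2 + 4 * ∑ i, Real.posLog ‖a i‖) := by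
    simp only [u, Finset.sum_add_distrib, mul_add,
      card_mul_sum_apply_embedding _ fun i => Real.posLog ‖a i‖, Finset.sum_const,
      Finset.card_univ, nsmul_eq_mul]
    ring
  have hnonneg := sum_log_nonneg_of_mem_lifts (prod_X_sub_C_mul_sub_mul_mem_lifts ha s)
  classical
  rw [← Finset.sum_add_sum_compl T] at hnonneg
  have hT : ∑ t ∈ T, Real.log ‖a (t (s 0)) * a (t (s 1)) - a (t (s 2)) * a (t (s 3))‖ ≤
      T.card * Real.log ε := by
    rw [← nsmul_eq_mul]
    exact Finset.sum_le_card_nsmul _ _ _ fun t ht =>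
      Real.log_le_log (norm_pos_iff.2 (sub_ne_zero.2 (hne t ht))) (hle t ht)
  have hcompl : ∑ t ∈ Tᶜ, Real.log ‖a (t (s 0)) * a (t (s 1)) - a (t (s 2)) * a (t (s 3))‖ ≤
      ∑ t, u t :=
    (Finset.sum_le_sum fun t _ => log_norm_mul_sub_mul_le _ _ _ _).trans
      (Finset.sum_le_univ_sum_of_nonneg hu)
  rw [← hsum]
  gcongr
  linarith

end Liouville

theorem abs_norm_pow_sub_norm_le {x b c : ℂ} {m e : ℕ} (h : x ^ e * (x ^ m + b) = c)
    (hx : 1 ≤ ‖x‖) : |‖x‖ ^ m - ‖b‖| ≤ ‖c‖ := by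
  have htriangle := abs_norm_sub_norm_le (x ^ m) (-b)
  rw [norm_neg, norm_pow, sub_neg_eq_add] at htriangle
  refine htriangle.trans ?_
  rw [← h, norm_mul, norm_pow]
  exact le_mul_of_one_le_left (norm_nonneg _) (one_le_pow₀ hx)

theorem abs_norm_sub_norm_mul_pow_le {x b c : ℂ} {m e : ℕ} (h : x ^ e * (x ^ m + b) = c)
    (hx : ‖x‖ ≤ 1) : |‖c‖ - ‖b‖ * ‖x‖ ^ e| ≤ ‖x‖ ^ e := by
  have htriangle := abs_norm_sub_norm_le c (b * x ^ e)
  rw [norm_mul, norm_pow, show c - b * x ^ e = x ^ e * x ^ m by rw [← h]; ring, norm_mul,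
    norm_pow, norm_pow] at htriangle
  exact htriangle.trans (mul_le_of_le_one_right (by positivity) (pow_le_one₀ (norm_nonneg x) hx))

theorem neg_of_antitone_of_sum_le {m e : ℕ} (hm : 0 < m) (he : 0 < e) {x : Fin (m + e) → ℝ}
    (hx : Antitone x) {L : ℝ} (hL : 0 < L) (hbig : ∀ i, 0 ≤ x i → L / m ≤ x i)
    (hsmall : ∀ i, -(L / e) ≤ x i) (hsum : ∑ i, x i ≤ L / m) {i : Fin (m + e)} (hi : m ≤ i) :
    x i < 0 := by
  by_contra! hxi
  have hcard : (m : ℝ) + 1 ≤ (Finset.Iic i).card := by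
    rw [Fin.card_Iic]
    exact_mod_cast Nat.succ_le_succ hi
  have hcompl : ((Finset.Iic i)ᶜ.card : ℝ) ≤ e - 1 := by
    rw [Finset.card_compl, Fintype.card_fin, Fin.card_Iic, Nat.cast_sub i.2]
    push_cast
    have : (m : ℝ) ≤ i := by exact_mod_cast hi
    linarith
  have hIic : (Finset.Iic i).card * (L / m) ≤ ∑ j ∈ Finset.Iic i, x j := by
    rw [← nsmul_eq_mul]
    exact Finset.card_nsmul_le_sum _ _ _ fun j hj =>
      hbig j (hxi.trans (hx (Finset.mem_Iic.1 hj)))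
  have hIicc : (Finset.Iic i)ᶜ.card * -(L / e) ≤ ∑ j ∈ (Finset.Iic i)ᶜ, x j := by
    rw [← nsmul_eq_mul]
    exact Finset.card_nsmul_le_sum _ _ _ fun j _ => hsmall j
  rw [← Finset.sum_add_sum_compl (Finset.Iic i)] at hsum
  have hLm : 0 < L / m := by positivity
  have hLe : 0 < L / e := by positivity
  have hm_mul : m * (L / m) = L := by field_simp
  have he_mul : e * (L / e) = L := by field_simp
  nlinarith

/-- The polynomial `X ^ (m + e) + 2 n X ^ e + 2`, irreducible by Eisenstein's criterion at `2`. For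
large `n` it has `m` roots of absolute value about `(2 n) ^ (1 / m)` and `e` roots of absolute
value about `n ^ (-1 / e)`. -/
noncomputable def testTrinomial (m e n : ℕ) : ℤ[X] :=
  X ^ (m + e) + (C (2 * (n : ℤ)) * X ^ e + C 2)

section TestTrinomial

variable {m e : ℕ} (n : ℕ)

theorem degree_testTrinomial_tail_lt (hm : 0 < m) :
    (C (2 * (n : ℤ)) * X ^ e + C 2 : ℤ[X]).degree < (m + e : ℕ) := by
  refine (degree_add_le _ _).trans_lt (max_lt ?_ ?_)
  · exact (degree_C_mul_X_pow_le _ _).trans_lt (by exact_mod_cast Nat.lt_add_of_pos_left hm)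
  · exact degree_C_le.trans_lt (by exact_mod_cast Nat.add_pos_left hm e)

theorem monic_testTrinomial (hm : 0 < m) : (testTrinomial m e n).Monic :=
  monic_X_pow_add (degree_testTrinomial_tail_lt n hm)

theorem natDegree_testTrinomial (hm : 0 < m) : (testTrinomial m e n).natDegree = m + e := by
  refine natDegree_eq_of_degree_eq_some ?_
  rw [testTrinomial, degree_add_eq_left_of_degree_lt] <;> rw [degree_X_pow]
  exact degree_testTrinomial_tail_lt n hm

theorem coeff_zero_testTrinomial (he : 0 < e) : (testTrinomial m e n).coeff 0 = 2 := by
  simp [testTrinomial, coeff_X_pow, he.ne, (Nat.add_pos_right m he).ne]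

theorem irreducible_testTrinomial (hm : 0 < m) (he : 0 < e) :
    Irreducible (testTrinomial m e n) := by
  have heisenstein : (testTrinomial m e n).IsEisensteinAt (Ideal.span {2}) := by
    refine ⟨?_, fun {i} hi => ?_, ?_⟩
    · rw [(monic_testTrinomial n hm).leadingCoeff, Ideal.mem_span_singleton]
      decide
    · rw [natDegree_testTrinomial n hm] at hi
      rw [Ideal.mem_span_singleton, testTrinomial, coeff_add, coeff_add, coeff_X_pow, if_neg hi.ne,
        zero_add, coeff_C_mul, coeff_C, mul_assoc]
      exact dvd_add (dvd_mul_right _ _) (by split_ifs <;> simp)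
    · rw [coeff_zero_testTrinomial n he, Ideal.span_singleton_pow, Ideal.mem_span_singleton]
      decide
  exact heisenstein.irreducible ((Ideal.span_singleton_prime two_ne_zero).2 Int.prime_two)
    (monic_testTrinomial n hm).isPrimitive (by rw [natDegree_testTrinomial n hm]; omega)

variable {n} {x : ℂ}

theorem pow_mul_eq_of_aeval_testTrinomial (hx : aeval x (testTrinomial m e n) = 0) :
    x ^ e * (x ^ m + 2 * n) = -2 := by
  simp only [testTrinomial, map_add, map_mul, map_pow, aeval_X, map_ofNat,
    map_natCast] at hx
  linear_combination hx

theorem log_norm_mem_Icc_of_one_le_norm (hm : 0 < m) (hn : 2 ≤ n)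
    (hx : aeval x (testTrinomial m e n) = 0) (h1 : 1 ≤ ‖x‖) :
    Real.log ‖x‖ ∈ Set.Icc (Real.log (2 * n - 2) / m) ((Real.log n + Real.log 4) / m) := by
  have hn' : (2 : ℝ) ≤ n := mod_cast hn
  have hbound := abs_le.1 (abs_norm_pow_sub_norm_le (pow_mul_eq_of_aeval_testTrinomial hx) h1)
  simp only [norm_mul, RCLike.norm_natCast, norm_neg, RCLike.norm_ofNat] at hbound
  rw [← Real.log_mul (by positivity) (by norm_num), Set.mem_Icc, div_le_iff₀ (by positivity),
    le_div_iff₀ (by positivity), mul_comm (Real.log ‖x‖),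
    ← Real.log_pow]
  exact ⟨Real.log_le_log (by linarith) (by linarith),
    Real.log_le_log (by positivity) (by linarith)⟩

theorem log_norm_mem_Icc_of_norm_le_one (he : 0 < e) (hn : 3 ≤ n)
    (hx : aeval x (testTrinomial m e n) = 0) (h1 : ‖x‖ ≤ 1) :
    Real.log ‖x‖ ∈ Set.Icc (-(Real.log (2 * n - 2) / e)) (-((Real.log n - Real.log 2) / e)) := by
  have hn' : (3 : ℝ) ≤ n := mod_cast hn
  have hbound := abs_le.1 (abs_norm_sub_norm_mul_pow_le (pow_mul_eq_of_aeval_testTrinomial hx) h1)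
  simp only [norm_mul, RCLike.norm_natCast, norm_neg, RCLike.norm_ofNat] at hbound
  have hpos : 0 < ‖x‖ ^ e := by
    by_contra! hle
    nlinarith [pow_nonneg (norm_nonneg x) e]
  rw [← Real.log_div (by positivity) two_ne_zero, ← neg_div, ← neg_div, ← Real.log_inv,
    ← Real.log_inv, Set.mem_Icc, div_le_iff₀ (by positivity), le_div_iff₀ (by positivity),
    mul_comm (Real.log ‖x‖),
    ← Real.log_pow]
  constructor
  · refine Real.log_le_log (inv_pos.2 (by linarith)) ?_
    rw [inv_le_iff_one_le_mul₀ (by linarith)]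
    nlinarith
  · refine Real.log_le_log hpos ?_
    rw [inv_div, le_div_iff₀ (by positivity)]
    nlinarith

end TestTrinomial

theorem minpoly_int_eq_of_irreducible_of_monic {p : ℤ[X]} (hirr : Irreducible p) (hp : p.Monic)
    {α : ℂ} (hroot : aeval α p = 0) : minpoly ℤ α = p := by
  refine map_injective (algebraMap ℤ ℚ) (algebraMap ℤ ℚ).injective_int ?_
  rw [← minpoly.isIntegrallyClosed_eq_field_fractions' ℚ ⟨p, hp, hroot⟩]
  refine (minpoly.eq_of_irreducible_of_monic
    ((hp.irreducible_iff_irreducible_map_fraction_map (K := ℚ)).1 hirr) ?_ (hp.map _)).symm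
  rw [aeval_map_algebraMap, hroot]

theorem exists_isConjugateLabelling_testTrinomial {m e : ℕ} (hm : 0 < m) (he : 0 < e) (n : ℕ) :
    ∃ (α : ℂ) (a : Fin (m + e) → ℂ), IsIntegral ℤ α ∧ minpoly ℤ α = testTrinomial m e n ∧
      IsConjugateLabelling α a := by
  have hmonic := monic_testTrinomial (e := e) n hm
  obtain ⟨α, hroot⟩ := IsAlgClosed.exists_aeval_eq_zero ℂ (testTrinomial m e n) <| by
    rw [degree_eq_natDegree hmonic.ne_zero, natDegree_testTrinomial n hm]
    exact_mod_cast (Nat.add_pos_left hm e).ne'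
  have hα : IsIntegral ℤ α := ⟨_, hmonic, hroot⟩
  have hminpoly := minpoly_int_eq_of_irreducible_of_monic (irreducible_testTrinomial n hm he)
    hmonic hroot
  obtain ⟨a, ha⟩ := exists_isConjugateLabelling (α := α) (d := m + e) <| by
    rw [← natDegree_minpoly_int hα, hminpoly, natDegree_testTrinomial n hm]
  exact ⟨α, a, hα, hminpoly, ha⟩

section TestConjugates

variable {m e n : ℕ} {α : ℂ} {a : Fin (m + e) → ℂ}

theorem IsConjugateLabelling.prod_norm_eq_two (ha : IsConjugateLabelling α a) (hα : IsIntegral ℤ α)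
    (he : 0 < e) (hminpoly : minpoly ℤ α = testTrinomial m e n) : ∏ i, ‖a i‖ = 2 := by
  rw [ha.prod_norm hα, hminpoly, coeff_zero_testTrinomial n he, Int.cast_ofNat, abs_two]

theorem IsConjugateLabelling.norm_lt_one_of_minpoly_eq_testTrinomial
    (ha : IsConjugateLabelling α a) (hα : IsIntegral ℤ α) (hm : 0 < m) (he : 0 < e)
    (hn : 2 ^ m + 2 ≤ n) (hminpoly : minpoly ℤ α = testTrinomial m e n) {i : Fin (m + e)}
    (hi : m ≤ i) : ‖a i‖ < 1 := by
  have hn3 : 3 ≤ n := by linarith [Nat.one_le_two_pow (n := m)]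
  have hprod := ha.prod_norm_eq_two hα he hminpoly
  have hne : ∀ i ∈ Finset.univ, ‖a i‖ ≠ 0 := Finset.prod_ne_zero_iff.1 (hprod ▸ two_ne_zero)
  have hpos (i) : 0 < ‖a i‖ := (norm_nonneg _).lt_of_ne' (hne i (Finset.mem_univ i))
  have hroot (i) : aeval (a i) (testTrinomial m e n) = 0 :=
    hminpoly ▸ ha.aeval_minpoly_eq_zero hα i
  have hL : m * Real.log 2 ≤ Real.log (2 * n - 2) := by
    have hn' : (2 : ℝ) ^ m + 2 ≤ n := mod_cast hn
    rw [← Real.log_pow]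
    exact Real.log_le_log (by positivity) (by linarith [pow_pos (two_pos (α := ℝ)) m])
  have hL0 : 0 < Real.log (2 * n - 2) := hL.trans_lt' (by positivity)
  have hbig (i) (h : 0 ≤ Real.log ‖a i‖) : Real.log (2 * n - 2) / m ≤ Real.log ‖a i‖ :=
    (log_norm_mem_Icc_of_one_le_norm hm (by omega) (hroot i)
      ((Real.log_nonneg_iff (hpos i)).1 h)).1
  have hsmall (i) : -(Real.log (2 * n - 2) / e) ≤ Real.log ‖a i‖ := by
    rcases le_total ‖a i‖ 1 with h1 | h1
    · exact (log_norm_mem_Icc_of_norm_le_one he hn3 (hroot i) h1).1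
    · exact (neg_nonpos.2 (by positivity)).trans (Real.log_nonneg h1)
  refine (Real.log_neg_iff (hpos i)).1 (neg_of_antitone_of_sum_le hm he
    (fun i j hij => Real.log_le_log (hpos j) (ha.antitone_norm hij)) hL0 hbig hsmall ?_ hi)
  rw [← Real.log_prod hne, hprod, le_div_iff₀ (by positivity), mul_comm]
  exact hL

theorem exists_testConjugates (hm : 0 < m) (he : 0 < e) (hn : 2 ^ m + 2 ≤ n) :
    ∃ (α : ℂ) (a : Fin (m + e) → ℂ), IsIntegral ℤ α ∧ (minpoly ℚ α).natDegree = m + e ∧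
      IsConjugateLabelling α a ∧ (∀ i, a i ≠ 0) ∧
      (∀ i, Real.log ‖a i‖ ≤ (Real.log n + Real.log 4) / m) ∧
      ∀ i : Fin (m + e), m ≤ i → Real.log ‖a i‖ ≤ -((Real.log n - Real.log 2) / e) := by
  have hn3 : 3 ≤ n := by linarith [Nat.one_le_two_pow (n := m)]
  obtain ⟨α, a, hα, hminpoly, ha⟩ := exists_isConjugateLabelling_testTrinomial hm he n
  have hroot (i) : aeval (a i) (testTrinomial m e n) = 0 :=
    hminpoly ▸ ha.aeval_minpoly_eq_zero hα i
  have hprod : ∏ i, ‖a i‖ ≠ 0 := ha.prod_norm_eq_two hα he hminpoly ▸ two_ne_zero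
  refine ⟨α, a, hα, ?_, ha, fun i => norm_ne_zero_iff.1
    (Finset.prod_ne_zero_iff.1 hprod i (Finset.mem_univ i)), fun i => ?_, fun i hi => ?_⟩
  · rw [← natDegree_minpoly_int hα, hminpoly, natDegree_testTrinomial n hm]
  · rcases le_total 1 ‖a i‖ with h1 | h1
    · exact (log_norm_mem_Icc_of_one_le_norm hm (by omega) (hroot i) h1).2
    · exact (Real.log_nonpos (norm_nonneg _) h1).trans (by positivity)
  · exact (log_norm_mem_Icc_of_norm_le_one he hn3 (hroot i)
      (ha.norm_lt_one_of_minpoly_eq_testTrinomial hα hm he hn hminpoly hi).le).2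

end TestConjugates

/-- The exponents `1, c₁, …, c_k` of the weighted product, extended by zero. -/
def extendedExponent {k : ℕ} (c : Fin k → ℝ) : ℕ → ℝ
  | 0 => 1
  | j + 1 => if h : j < k then c ⟨j, h⟩ else 0

/-- The logarithms `log |a i|`, extended by zero. -/
noncomputable def logNorm {d : ℕ} (a : Fin d → ℂ) (i : ℕ) : ℝ :=
  if h : i < d then Real.log ‖a ⟨i, h⟩‖ else 0

section WeightedProduct

variable {k d : ℕ} {c : Fin k → ℝ} {a : Fin d → ℂ}

theorem logNorm_val (a : Fin d → ℂ) (i : Fin d) : logNorm a i = Real.log ‖a i‖ :=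
  dif_pos i.2

theorem sum_range_logNorm (a : Fin d → ℂ) :
    ∑ i ∈ Finset.range d, logNorm a i = ∑ i, Real.log ‖a i‖ := by
  simp only [← Fin.sum_univ_eq_sum_range, logNorm_val]

theorem antitoneOn_logNorm (ha : Antitone fun i => ‖a i‖) (h0 : ∀ i, a i ≠ 0) :
    AntitoneOn (logNorm a) (Set.Iio d) := fun i hi j hj hij => by
  rw [logNorm, logNorm, dif_pos (Set.mem_Iio.1 hi), dif_pos (Set.mem_Iio.1 hj)]
  exact Real.log_le_log (norm_pos_iff.2 (h0 _)) (ha (Fin.mk_le_mk.2 hij))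

theorem extendedExponent_nonneg (hc : ∀ j, 0 ≤ c j) (j : ℕ) : 0 ≤ extendedExponent c j := by
  cases j with
  | zero => exact zero_le_one
  | succ j =>
    rw [extendedExponent]
    split_ifs
    exacts [hc _, le_rfl]

theorem weightedProduct_pos (hkd : k < d) (c : Fin k → ℝ) (h0 : ∀ i, a i ≠ 0) :
    0 < weightedProduct hkd c a :=
  mul_pos (norm_pos_iff.2 (h0 _))
    (Finset.prod_pos fun _ _ => Real.rpow_pos_of_pos (norm_pos_iff.2 (h0 _)) _)

theorem log_weightedProduct (hkd : k < d) (c : Fin k → ℝ) (h0 : ∀ i, a i ≠ 0) :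
    Real.log (weightedProduct hkd c a) =
      ∑ j ∈ Finset.range (k + 1), extendedExponent c j * logNorm a j := by
  have hpos (i) : 0 < ‖a i‖ := norm_pos_iff.2 (h0 i)
  have hrpow : ∀ j ∈ Finset.univ, ‖a (Fin.castLE hkd (Fin.succ j))‖ ^ c j ≠ 0 :=
    fun j _ => (Real.rpow_pos_of_pos (hpos _) _).ne'
  rw [weightedProduct, Real.log_mul (hpos _).ne' (Finset.prod_ne_zero_iff.2 hrpow),
    Real.log_prod hrpow, ← Fin.sum_univ_eq_sum_range
      (fun j => extendedExponent c j * logNorm a j), Fin.sum_univ_succ]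
  congr 1
  · rw [Fin.val_zero, extendedExponent, one_mul]
    exact (logNorm_val a (Fin.castLE hkd 0)).symm
  · refine Finset.sum_congr rfl fun j _ => ?_
    rw [Real.log_rpow (hpos _), Fin.val_succ, extendedExponent, dif_pos j.2]
    exact congrArg _ (logNorm_val a (Fin.castLE hkd j.succ)).symm

theorem nonpos_of_eventually_mul_log_le {A B : ℝ}
    (h : ∀ᶠ n : ℕ in Filter.atTop, A * Real.log n ≤ B) : A ≤ 0 := by
  by_contra! hA
  have htendsto : Filter.Tendsto (fun n : ℕ => A * Real.log n) Filter.atTop Filter.atTop :=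
    (Real.tendsto_log_atTop.comp tendsto_natCast_atTop_atTop).const_mul_atTop hA
  obtain ⟨n, hle, hgt⟩ := (h.and (htendsto.eventually_gt_atTop B)).exists
  exact hgt.not_ge hle

theorem sum_extendedExponent_mul_log_le {m e : ℕ} {hkd : k < m + e} (hc : c ∈ exponentSet hkd)
    (hm : 0 < m) (he : 0 < e) (hmk : m ≤ k + 1) {n : ℕ} (hn : 2 ^ m + 2 ≤ n) :
    (∑ j ∈ Finset.Ico m (k + 1), extendedExponent c j) * ((Real.log n - Real.log 2) / e) ≤
      (∑ j ∈ Finset.range m, extendedExponent c j) * ((Real.log n + Real.log 4) / m) := by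
  obtain ⟨α, a, hα, hd, ha, h0, hup, hlow⟩ := exists_testConjugates hm he hn
  have hlog := Real.log_nonneg (hc.2 α hα hd a ha)
  rw [log_weightedProduct hkd c h0, ← Finset.sum_range_add_sum_Ico _ hmk] at hlog
  have hrange : ∑ j ∈ Finset.range m, extendedExponent c j * logNorm a j ≤
      (∑ j ∈ Finset.range m, extendedExponent c j) * ((Real.log n + Real.log 4) / m) := by
    rw [Finset.sum_mul]
    refine Finset.sum_le_sum fun j hj => mul_le_mul_of_nonneg_left ?_
      (extendedExponent_nonneg hc.1 j)
    rw [logNorm, dif_pos (by have := Finset.mem_range.1 hj; omega)]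
    exact hup _
  have hIco : ∑ j ∈ Finset.Ico m (k + 1), extendedExponent c j * logNorm a j ≤
      (∑ j ∈ Finset.Ico m (k + 1), extendedExponent c j) *
        -((Real.log n - Real.log 2) / e) := by
    rw [Finset.sum_mul]
    refine Finset.sum_le_sum fun j hj => mul_le_mul_of_nonneg_left ?_
      (extendedExponent_nonneg hc.1 j)
    have hj' := Finset.mem_Ico.1 hj
    rw [logNorm, dif_pos (by omega)]
    exact hlow _ hj'.1
  linarith

theorem mul_sum_extendedExponent_le {hkd : k < d} (hc : c ∈ exponentSet hkd) {m : ℕ}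
    (hmk : m ≤ k) :
    m * ∑ j ∈ Finset.range (k + 1), extendedExponent c j ≤
      d * ∑ j ∈ Finset.range m, extendedExponent c j := by
  rcases Nat.eq_zero_or_pos m with rfl | hm
  · simp
  obtain ⟨e, rfl⟩ := Nat.exists_eq_add_of_le (hmk.trans hkd.le)
  have he : 0 < e := by omega
  rw [← Finset.sum_range_add_sum_Ico _ (hmk.trans k.le_succ)]
  set P := ∑ j ∈ Finset.range m, extendedExponent c j
  set R := ∑ j ∈ Finset.Ico m (k + 1), extendedExponent c j
  have hle : R / e - P / m ≤ 0 := by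
    refine nonpos_of_eventually_mul_log_le (B := P / m * Real.log 4 + R / e * Real.log 2) ?_
    filter_upwards [Filter.eventually_ge_atTop (2 ^ m + 2)] with n hn
    have := sum_extendedExponent_mul_log_le hc hm he (hmk.trans k.le_succ) hn
    have hR : R * ((Real.log n - Real.log 2) / e) = R / e * (Real.log n - Real.log 2) := by ring
    have hP : P * ((Real.log n + Real.log 4) / m) = P / m * (Real.log n + Real.log 4) := by ring
    linarith
  rw [sub_nonpos, div_le_div_iff₀ (by positivity) (by positivity)] at hle
  push_cast
  linarith

theorem sum_mul_le_sum_mul_of_antitoneOn {v x : ℕ → ℝ} {n : ℕ} (hx : AntitoneOn x (Set.Iic n))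
    (hv : ∀ m ≤ n, 0 ≤ ∑ j ∈ Finset.range m, v j) :
    (∑ j ∈ Finset.range (n + 1), v j) * x n ≤ ∑ j ∈ Finset.range (n + 1), v j * x j := by
  induction n with
  | zero => simp
  | succ n ih =>
    have hprev := ih (hx.mono (Set.Iic_subset_Iic.2 n.le_succ)) fun m hm =>
      hv m (hm.trans n.le_succ)
    have hstep := mul_le_mul_of_nonneg_left
      (hx (Set.mem_Iic.2 n.le_succ) Set.self_mem_Iic n.le_succ) (hv (n + 1) le_rfl)
    rw [Finset.sum_range_succ _ (n + 1), Finset.sum_range_succ _ (n + 1), add_mul]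
    linarith

theorem sub_le_sum_Ico_sub {x : ℕ → ℝ} {k n : ℕ} (hx : AntitoneOn x (Set.Iic n)) (hkn : k ≤ n) :
    x k - x n ≤ ∑ j ∈ Finset.Ico (k + 1) (n + 1), (x k - x j) := by
  rcases hkn.eq_or_lt with rfl | hlt
  · simp
  · refine Finset.single_le_sum (f := fun j => x k - x j) (fun j hj => ?_)
      (Finset.mem_Ico.2 ⟨hlt, n.lt_succ_self⟩)
    have hj' := Finset.mem_Ico.1 hj
    exact sub_nonneg.2 (hx hkn (Nat.le_of_lt_succ hj'.2) (Nat.le_of_succ_le hj'.1))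

theorem sum_log_norm_add_sub_le {hkd : k < d} (hc : c ∈ exponentSet hkd)
    (ha : Antitone fun i => ‖a i‖) (h0 : ∀ i, a i ≠ 0) (hsum : 0 ≤ ∑ i, Real.log ‖a i‖) :
    ∑ i, Real.log ‖a i‖ + (logNorm a k - logNorm a (d - 1)) ≤
      d * Real.log (weightedProduct hkd c a) := by
  obtain ⟨n, rfl⟩ := Nat.exists_eq_add_one_of_ne_zero (Nat.ne_zero_of_lt hkd)
  rw [log_weightedProduct hkd c h0, Nat.add_sub_cancel]
  rw [← sum_range_logNorm, ← Finset.sum_range_add_sum_Ico _ hkd] at hsum ⊢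
  have hx : AntitoneOn (logNorm a) (Set.Iic n) :=
    (antitoneOn_logNorm ha h0).mono fun i hi => Nat.lt_succ_of_le hi
  set x := logNorm a
  set w := extendedExponent c
  set W := ∑ j ∈ Finset.range (k + 1), w j
  have hW1 : 1 ≤ W :=
    Finset.single_le_sum (f := w) (fun j _ => extendedExponent_nonneg hc.1 j)
      (Finset.mem_range.2 k.succ_pos)
  have habel := sum_mul_le_sum_mul_of_antitoneOn (v := fun j => (n + 1 : ℕ) * w j - W)
    (hx.mono (Set.Iic_subset_Iic.2 (Nat.le_of_lt_succ hkd))) fun m hm => by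
      rw [Finset.sum_sub_distrib, ← Finset.mul_sum, Finset.sum_const, Finset.card_range,
        nsmul_eq_mul, sub_nonneg]
      exact mul_sum_extendedExponent_le hc hm
  simp only [Finset.sum_sub_distrib, sub_mul, mul_assoc, ← Finset.mul_sum, Finset.sum_const,
    Finset.card_range, nsmul_eq_mul] at habel
  have hspread := sub_le_sum_Ico_sub hx (Nat.le_of_lt_succ hkd)
  have hspread0 : 0 ≤ x k - x n :=
    sub_nonneg.2 (hx (Nat.le_of_lt_succ hkd) Set.self_mem_Iic (Nat.le_of_lt_succ hkd))
  set U := ∑ j ∈ Finset.Ico (k + 1) (n + 1), (x k - x j) with hU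
  rw [Finset.sum_sub_distrib, Finset.sum_const, Nat.card_Ico, nsmul_eq_mul, Nat.cast_sub hkd] at hU
  calc _ ≤ ∑ j ∈ Finset.range (k + 1), x j + ∑ j ∈ Finset.Ico (k + 1) (n + 1), x j + U := by
        linarith
    _ ≤ W * (∑ j ∈ Finset.range (k + 1), x j + ∑ j ∈ Finset.Ico (k + 1) (n + 1), x j + U) :=
        le_mul_of_one_le_left (by linarith) hW1
    _ ≤ _ := by
        rw [hU]
        linarith

end WeightedProduct

section ConjugatePairs

variable {ι : Type*} [Fintype ι] {a : ι → ℂ} {τ : Equiv.Perm ι} {ε E : ℝ}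

theorem card_mul_neg_log_le_of_norm_ne {κ : Type*} [Fintype κ]
    (ha : ∏ i, (X - C (a i)) ∈ lifts (algebraMap ℤ ℂ)) (hτ : ∀ i, a (τ i) = starRingEnd ℂ (a i))
    (s : Fin 4 → κ) {T : Finset (ι × ι)}
    (hs : ∀ p ∈ T, ∃ t : κ → ι, Function.Injective t ∧
      t (s 0) = p.1 ∧ t (s 1) = τ p.1 ∧ t (s 2) = p.2 ∧ t (s 3) = τ p.2)
    (hne : ∀ p ∈ T, ‖a p.1‖ ≠ ‖a p.2‖) (hle : ∀ p ∈ T, |‖a p.1‖ ^ 2 - ‖a p.2‖ ^ 2| ≤ ε) :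
    Fintype.card ι * (T.card * -Real.log ε) ≤
      Fintype.card (κ ↪ ι) * (Fintype.card ι * Real.log 2 + 4 * ∑ i, Real.posLog ‖a i‖) := by
  choose t ht h₀ h₁ h₂ h₃ using hs
  have hinj : Function.Injective fun p : T => (⟨t p p.2, ht p p.2⟩ : κ ↪ ι) := fun p q hpq => by
    have h (j : Fin 4) : t p p.2 (s j) = t q q.2 (s j) := DFunLike.congr_fun hpq (s j)
    exact Subtype.ext (Prod.ext (by simpa only [h₀] using h 0) (by simpa only [h₂] using h 2))
  have hsq (p : T) : a (t p p.2 (s 0)) * a (t p p.2 (s 1)) = ((‖a p.1.1‖ ^ 2 : ℝ) : ℂ) ∧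
      a (t p p.2 (s 2)) * a (t p p.2 (s 3)) = ((‖a p.1.2‖ ^ 2 : ℝ) : ℂ) := by
    simp [h₀, h₁, h₂, h₃, hτ, Complex.mul_conj']
  have key := card_mul_neg_log_le ha s (T := Finset.univ.map ⟨_, hinj⟩) (ε := ε)
  simp only [Finset.forall_mem_map, Finset.card_map, Function.Embedding.coeFn_mk, hsq,
    Finset.card_univ, Fintype.card_coe] at key
  refine key (fun p _ => ?_) fun p _ => ?_
  · rw [Ne, Complex.ofReal_inj, sq_eq_sq₀ (norm_nonneg _) (norm_nonneg _)]
    exact hne p p.2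
  · rw [← Complex.ofReal_sub, Complex.norm_real, Real.norm_eq_abs]
    exact hle p p.2

theorem neg_log_le_of_norm_ne (ha : ∏ i, (X - C (a i)) ∈ lifts (algebraMap ℤ ℂ))
    (hτ : ∀ i, a (τ i) = starRingEnd ℂ (a i)) {m : ℕ} (hm : m ≤ 3) (s : Fin 4 → Fin (m + 1))
    {T : Finset (ι × ι)} (hT : T.Nonempty)
    (hs : ∀ p ∈ T, ∃ t : Fin (m + 1) → ι, Function.Injective t ∧
      t (s 0) = p.1 ∧ t (s 1) = τ p.1 ∧ t (s 2) = p.2 ∧ t (s 3) = τ p.2)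
    (hne : ∀ p ∈ T, ‖a p.1‖ ≠ ‖a p.2‖) (hle : ∀ p ∈ T, |‖a p.1‖ ^ 2 - ‖a p.2‖ ^ 2| ≤ ε)
    (hE : 4 * ((Fintype.card ι - 1).descFactorial m : ℝ) ≤ T.card * E) :
    -Real.log ε ≤ Fintype.card ι ^ 4 * Real.log 2 + E * ∑ i, Real.posLog ‖a i‖ := by
  have hι : 0 < Fintype.card ι := Fintype.card_pos_iff.2 ⟨hT.choose.1⟩
  have key := card_mul_neg_log_le_of_norm_ne ha hτ s hs hne hle
  rw [Fintype.card_embedding_eq, Fintype.card_fin] at key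
  set n := Fintype.card ι
  obtain ⟨q, hq⟩ : ∃ q, n = q + 1 := Nat.exists_eq_add_one.2 hι
  rw [hq, Nat.succ_descFactorial_succ, ← hq, Nat.cast_mul, mul_assoc,
    mul_le_mul_iff_right₀ (by exact_mod_cast hι)] at key
  rw [hq, Nat.add_sub_cancel] at hE
  have hq4 : (q.descFactorial m * n : ℝ) ≤ n ^ 4 := by
    have hqm := (Nat.descFactorial_le_pow q m).trans
      ((Nat.pow_le_pow_left (by omega : q ≤ n) m).trans (Nat.pow_le_pow_right hι hm))
    exact_mod_cast (Nat.mul_le_mul_right n hqm).trans_eq (by ring)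
  have hT1 : (1 : ℝ) ≤ T.card := by exact_mod_cast hT.card_pos
  have hX : 0 ≤ ∑ i, Real.posLog ‖a i‖ := Finset.sum_nonneg fun i _ => Real.posLog_nonneg
  refine le_of_mul_le_mul_left ?_ (zero_lt_one.trans_le hT1)
  calc T.card * -Real.log ε
      ≤ q.descFactorial m * (n * Real.log 2 + 4 * ∑ i, Real.posLog ‖a i‖) := key
    _ = 1 * (q.descFactorial m * n) * Real.log 2 +
          4 * q.descFactorial m * ∑ i, Real.posLog ‖a i‖ := by ring
    _ ≤ T.card * n ^ 4 * Real.log 2 + T.card * E * ∑ i, Real.posLog ‖a i‖ := by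
        gcongr
    _ = T.card * (n ^ 4 * Real.log 2 + E * ∑ i, Real.posLog ‖a i‖) := by ring

theorem neg_log_le_of_conj_fixed (ha : ∏ i, (X - C (a i)) ∈ lifts (algebraMap ℤ ℂ))
    (hinj : Function.Injective a) (hτ : ∀ i, a (τ i) = starRingEnd ℂ (a i)) {i j : ι}
    (hi : τ i = i) (hne : ‖a i‖ ≠ ‖a j‖) (hle : |‖a i‖ ^ 2 - ‖a j‖ ^ 2| ≤ ε)
    (hι : 4 ≤ Fintype.card ι)
    (hE : 2 * ((Fintype.card ι : ℝ) - 1) * (Fintype.card ι - 2) ≤ E) :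
    -Real.log ε ≤ Fintype.card ι ^ 4 * Real.log 2 + E * ∑ i, Real.posLog ‖a i‖ := by
  have hιR : (4 : ℝ) ≤ Fintype.card ι := by exact_mod_cast hι
  have hnorm : ‖a (τ j)‖ = ‖a j‖ := by rw [hτ, Complex.norm_conj]
  have hττ : τ (τ j) = j := hinj (by rw [hτ, hτ, Complex.conj_conj])
  have hij : i ≠ j := fun h => hne (h ▸ rfl)
  classical
  by_cases hj : τ j = j
  · refine neg_log_le_of_norm_ne ha hτ (m := 1) (by norm_num) ![0, 0, 1, 1] (T := {(i, j)})
      (Finset.singleton_nonempty _) ?_ (by simpa using hne) (by simpa using hle) ?_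
    · rintro _ hp
      obtain rfl := Finset.mem_singleton.1 hp
      exact ⟨![i, j], injective_pair_iff_ne.2 hij, rfl, hi.symm, rfl, hj.symm⟩
    · rw [Nat.descFactorial_one, Nat.cast_pred (by omega), Finset.card_singleton]
      push_cast
      nlinarith
  · have hiτj : i ≠ τ j := fun h => hne (h ▸ hnorm)
    refine neg_log_le_of_norm_ne ha hτ (m := 2) (by norm_num) ![0, 0, 1, 2]
      (T := {(i, j), (i, τ j)}) (Finset.insert_nonempty _ _) ?_
      (by simpa [hnorm] using hne) (by simpa [hnorm] using hle) ?_
    · intro p hp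
      rcases Finset.mem_insert.1 hp with rfl | hp
      · exact ⟨![i, j, τ j], List.nodup_ofFn.1 (by simp [hij, hiτj, Ne.symm hj]),
          rfl, hi.symm, rfl, rfl⟩
      · obtain rfl := Finset.mem_singleton.1 hp
        exact ⟨![i, τ j, j], List.nodup_ofFn.1 (by simp [hij, hiτj, hj]),
          rfl, hi.symm, rfl, hττ.symm⟩
    · rw [Nat.cast_descFactorial_two, Nat.cast_pred (by omega),
        Finset.card_pair (by simpa using Ne.symm hj)]
      push_cast
      linarith

theorem neg_log_le_of_conj_ne_self (ha : ∏ i, (X - C (a i)) ∈ lifts (algebraMap ℤ ℂ))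
    (hτ : ∀ i, a (τ i) = starRingEnd ℂ (a i)) {B : Finset ι} {μ : ℕ} (hB : ∀ i ∈ B, τ i ≠ i)
    (hle : ∀ i ∈ B, ∀ j ∈ B, |‖a i‖ ^ 2 - ‖a j‖ ^ 2| ≤ ε) (hB4 : 4 ≤ B.card) (hμ : 0 < μ)
    (hcard : ∀ i ∈ B, 2 * μ ≤ Finset.card {j ∈ B | ‖a i‖ ≠ ‖a j‖})
    (hE : ((Fintype.card ι : ℝ) - 1) * (Fintype.card ι - 2) * (Fintype.card ι - 3) / (2 * μ) ≤ E) :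
    -Real.log ε ≤ Fintype.card ι ^ 4 * Real.log 2 + E * ∑ i, Real.posLog ‖a i‖ := by
  have hnorm (i : ι) : ‖a (τ i)‖ = ‖a i‖ := by rw [hτ, Complex.norm_conj]
  let T : Finset (ι × ι) := {p ∈ B ×ˢ B | ‖a p.1‖ ≠ ‖a p.2‖}
  have hT : 8 * μ ≤ T.card := calc
    8 * μ ≤ B.card • (2 * μ) := by rw [smul_eq_mul]; nlinarith
    _ ≤ ∑ i ∈ B, Finset.card {j ∈ B | ‖a i‖ ≠ ‖a j‖} := Finset.card_nsmul_le_sum _ _ _ hcard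
    _ = T.card := by simp only [T, Finset.card_filter, Finset.sum_product]
  have hT' {p} (hp : p ∈ T) : (p.1 ∈ B ∧ p.2 ∈ B) ∧ ‖a p.1‖ ≠ ‖a p.2‖ := by
    simpa only [T, Finset.mem_filter, Finset.mem_product] using hp
  refine neg_log_le_of_norm_ne ha hτ le_rfl id (T := T) (Finset.card_pos.1 (by omega))
    (fun p hp => ⟨![p.1, τ p.1, p.2, τ p.2], List.nodup_ofFn.1 ?_, rfl, rfl, rfl, rfl⟩)
    (fun p hp => (hT' hp).2) (fun p hp => hle _ (hT' hp).1.1 _ (hT' hp).1.2) ?_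
  · obtain ⟨⟨hp₁, hp₂⟩, hne⟩ := hT' hp
    have h₁₂ : p.1 ≠ p.2 := fun h => hne (h ▸ rfl)
    have h₁τ : p.1 ≠ τ p.2 := fun h => hne (by rw [h, hnorm])
    have hτ₂ : τ p.1 ≠ p.2 := fun h => hne (by rw [← h, hnorm])
    simp [h₁₂, h₁τ, hτ₂, (hB _ hp₁).symm, (hB _ hp₂).symm]
  · rw [div_le_iff₀ (by positivity)] at hE
    obtain ⟨q, hq⟩ := Nat.exists_eq_add_of_le' (hB4.trans (Finset.card_le_univ B))
    have hcast : ((Fintype.card ι - 1).descFactorial 3 : ℝ) =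
        (Fintype.card ι - 1) * (Fintype.card ι - 2) * (Fintype.card ι - 3) := by
      rw [hq]
      simp only [Nat.descFactorial_succ, Nat.descFactorial_zero, Nat.reduceSubDiff]
      push_cast
      ring
    have hE0 : 0 ≤ E * (2 * μ) := (hcast ▸ Nat.cast_nonneg _).trans hE
    have hTR : 8 * (μ : ℝ) ≤ T.card := by exact_mod_cast hT
    have hmono := mul_le_mul_of_nonneg_right hTR (nonneg_of_mul_nonneg_left hE0 (by positivity))
    linarith

end ConjugatePairs

theorem even_card_of_involutive {ι : Type*} {B : Finset ι} {f : ι → ι} (hf : Function.Involutive f)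
    (hB : ∀ i ∈ B, f i ∈ B) (hne : ∀ i ∈ B, f i ≠ i) : Even B.card := by
  rw [← ZMod.natCast_eq_zero_iff_even, Finset.card_eq_sum_ones, Nat.cast_sum]
  exact Finset.sum_involution (fun i _ => f i) (fun _ _ => by decide) (fun i hi _ => hne i hi) hB
    fun i _ => hf i

theorem card_le_three_mul_card_filter_ne_add {ι R : Type*} [Fintype ι] [DecidableEq R] {f : ι → R}
    {B : Finset ι} {k : ℕ} (hB : Fintype.card ι - k ≤ B.card) {i : ι}
    (hi : 3 * Finset.card {j | f j = f i} ≤ 2 * Fintype.card ι) :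
    Fintype.card ι ≤ 3 * (Finset.card {j ∈ B | f j ≠ f i} + k) := by
  have hsplit : Finset.card {j ∈ B | f j = f i} + Finset.card {j ∈ B | f j ≠ f i} = B.card :=
    Finset.card_filter_add_card_filter_not _
  have hle : Finset.card {j ∈ B | f j = f i} ≤ Finset.card {j | f j = f i} :=
    Finset.card_le_card (Finset.filter_subset_filter _ (Finset.subset_univ B))
  omega

theorem exists_mem_ne_of_card_filter_eq_le {ι R : Type*} [Fintype ι] [DecidableEq R] {f : ι → R}
    {B : Finset ι} {k : ℕ} (hk : 3 * k < Fintype.card ι) (hB : Fintype.card ι - k ≤ B.card) {i : ι}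
    (hi : 3 * Finset.card {j | f j = f i} ≤ 2 * Fintype.card ι) : ∃ j ∈ B, f j ≠ f i := by
  have hcard := card_le_three_mul_card_filter_ne_add hB hi
  obtain ⟨j, hj⟩ := Finset.card_pos.1 (by omega : 0 < Finset.card {j ∈ B | f j ≠ f i})
  exact ⟨j, Finset.mem_filter.1 hj⟩

theorem muConst_pos {k d : ℕ} (h3 : 3 * k < d) : 0 < muConst k d := by
  have hceil : (k : ℤ) < ⌈(d : ℚ) / 3⌉ := by
    rw [Int.lt_ceil, lt_div_iff₀ (by norm_num)]
    exact_mod_cast (by omega : k * 3 < d)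
  have hceil' : (k : ℚ) < (⌈(d : ℚ) / 3⌉ : ℚ) := by exact_mod_cast hceil
  rw [muConst, Int.lt_ceil]
  push_cast
  linarith

theorem two_mul_muConst_le {k d n : ℕ} (hn : Even n) (h : d ≤ 3 * (n + k)) :
    2 * muConst k d ≤ n := by
  obtain ⟨q, rfl⟩ := hn
  have hceil : ⌈(d : ℚ) / 3⌉ ≤ ((q + q + k : ℕ) : ℤ) := by
    rw [Int.ceil_le, div_le_iff₀ (by norm_num)]
    exact_mod_cast (by omega : d ≤ (q + q + k) * 3)
  have hceil' : (⌈(d : ℚ) / 3⌉ : ℚ) ≤ q + q + k := by exact_mod_cast hceil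
  have hμ : muConst k d ≤ q := by
    rw [muConst, Int.ceil_le]
    push_cast
    linarith
  omega

theorem two_le_mainExponent {k d : ℕ} (hd : 3 < d) : 2 ≤ mainExponent k d := by
  have hdR : (4 : ℝ) ≤ d := by exact_mod_cast hd
  exact le_max_of_le_left (by nlinarith)

theorem mainExponent_le {k d : ℕ} (h3 : 3 * k < d) : mainExponent k d ≤ 2 * (d : ℝ) ^ 3 := by
  have hd : (1 : ℝ) ≤ d := by exact_mod_cast (by omega : 1 ≤ d)
  have hμ : (1 : ℝ) ≤ muConst k d := by exact_mod_cast muConst_pos h3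
  have hd3 : (d : ℝ) ≤ d ^ 3 := le_self_pow₀ hd (by norm_num)
  refine max_le (by nlinarith) ?_
  rw [div_le_iff₀ (by linarith)]
  calc ((d : ℝ) - 1) * (d - 2) * (d - 3) ≤ 2 * d ^ 3 * 2 := by nlinarith [sq_nonneg ((d : ℝ) - 1)]
    _ ≤ 2 * d ^ 3 * (2 * muConst k d) := by gcongr; linarith

namespace IsConjugateLabelling

variable {α : ℂ} {k d : ℕ} {a : Fin d → ℂ}

theorem neg_log_le_of_forall_abs_sub_le (h : IsConjugateLabelling α a) (hα : IsIntegral ℤ α)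
    (hd : 3 < d) (h3 : 3 * k < d) {M ε : ℝ} (hM : d - k ≤ Finset.card {i | ‖a i‖ ≤ M})
    (hcard : ∀ i, ‖a i‖ ≤ M → 3 * Finset.card {j | ‖a j‖ = ‖a i‖} ≤ 2 * d)
    (hε : ∀ i j, ‖a i‖ ≤ M → ‖a j‖ ≤ M → |‖a i‖ ^ 2 - ‖a j‖ ^ 2| ≤ ε) :
    -Real.log ε ≤ d ^ 4 * Real.log 2 + mainExponent k d * ∑ i, Real.posLog ‖a i‖ := by
  have hlift := h.prod_X_sub_C_mem_lifts hα
  have hinj := h.injective hα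
  obtain ⟨τ, hτ⟩ := exists_perm_conj_of_mem_lifts hlift hinj
  have hττ : Function.Involutive τ := fun i => hinj (by rw [hτ, hτ, Complex.conj_conj])
  have hnorm (i : Fin d) : ‖a (τ i)‖ = ‖a i‖ := by rw [hτ, Complex.norm_conj]
  set B : Finset (Fin d) := {i | ‖a i‖ ≤ M} with hB
  have hmem (i : Fin d) : i ∈ B ↔ ‖a i‖ ≤ M := by simp [hB]
  have hother (i) (hi : i ∈ B) : d ≤ 3 * (Finset.card {j ∈ B | ‖a j‖ ≠ ‖a i‖} + k) := by
    simpa using card_le_three_mul_card_filter_ne_add (B := B) (f := fun i => ‖a i‖)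
      (by simpa using hM) (by simpa using hcard i ((hmem i).1 hi))
  have hle (i) (hi : i ∈ B) (j) (hj : j ∈ B) := hε i j ((hmem i).1 hi) ((hmem j).1 hj)
  by_cases hreal : ∃ i ∈ B, τ i = i
  · obtain ⟨i, hi, hτi⟩ := hreal
    obtain ⟨j, hj, hij⟩ := exists_mem_ne_of_card_filter_eq_le (f := fun i => ‖a i‖)
      (by simpa using h3) (by simpa using hM) (by simpa using hcard i ((hmem i).1 hi))
    simpa using neg_log_le_of_conj_fixed hlift hinj hτ hτi hij.symm (hle i hi j hj) 
      (by rwa [Fintype.card_fin]) (by rw [Fintype.card_fin]; exact le_max_left _ _)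
  · push Not at hreal
    have heven (i : Fin d) : Even (Finset.card {j ∈ B | ‖a j‖ ≠ ‖a i‖}) := by
      refine even_card_of_involutive hττ (fun j hj => ?_) fun j hj =>
        hreal j (Finset.mem_filter.1 hj).1
      simpa [hmem, hnorm] using hj
    have hB4 : 4 ≤ B.card := by
      obtain ⟨q, hq⟩ := even_card_of_involutive hττ (B := B) (fun i hi => by
        rwa [hmem, hnorm, ← hmem]) hreal
      omega
    obtain ⟨μ, hμ⟩ := Int.eq_ofNat_of_zero_le (muConst_pos h3).le
    have hμpos := muConst_pos h3
    simpa using neg_log_le_of_conj_ne_self (μ := μ) hlift hτ hreal hle hB4 (by omega)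
      (fun i hi => by
        have := two_mul_muConst_le (heven i) (hother i hi)
        simp only [ne_comm (a := ‖a i‖)]
        omega)
      (by rw [Fintype.card_fin, ← Int.cast_natCast μ, ← hμ]; exact le_max_right _ _)

end IsConjugateLabelling

section Spread

theorem abs_sq_sub_sq_le_of_log_mem_Icc {r s x y : ℝ} (hx : 0 < x) (hy : 0 < y) (hs : s ≤ 1 / 2)
    (hxr : Real.log x ∈ Set.Icc r (r + s)) (hyr : Real.log y ∈ Set.Icc r (r + s)) :
    |x ^ 2 - y ^ 2| ≤ Real.exp (2 * r) * (4 * s) := by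
  have hs0 : 0 ≤ s := by linarith [hxr.1, hxr.2]
  have hmem {z : ℝ} (hz : 0 < z) (hzr : Real.log z ∈ Set.Icc r (r + s)) :
      z ^ 2 ∈ Set.Icc (Real.exp (2 * r)) (Real.exp (2 * r) * Real.exp (2 * s)) := by
    have hsq : z ^ 2 = Real.exp (2 * Real.log z) := by
      rw [two_mul, Real.exp_add, Real.exp_log hz, sq]
    rw [hsq, ← Real.exp_add]
    exact ⟨Real.exp_le_exp.2 (by linarith [hzr.1]), Real.exp_le_exp.2 (by linarith [hzr.2])⟩
  have hexp : Real.exp (2 * s) - 1 ≤ 4 * s := by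
    have := Real.abs_exp_sub_one_le (x := 2 * s) (by rw [abs_of_nonneg] <;> linarith)
    rw [abs_of_nonneg (by linarith : 0 ≤ 2 * s)] at this
    linarith [le_abs_self (Real.exp (2 * s) - 1)]
  calc |x ^ 2 - y ^ 2| ≤ Real.exp (2 * r) * Real.exp (2 * s) - Real.exp (2 * r) :=
        abs_sub_le_of_le_of_le (hmem hx hxr).1 (hmem hx hxr).2 (hmem hy hyr).1 (hmem hy hyr).2
    _ = Real.exp (2 * r) * (Real.exp (2 * s) - 1) := by ring
    _ ≤ Real.exp (2 * r) * (4 * s) := by gcongr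

variable {d : ℕ} {a : Fin d → ℂ}

theorem logNorm_pred_le_log_norm (ha : Antitone fun i => ‖a i‖) (h0 : ∀ i, a i ≠ 0) (i : Fin d) :
    logNorm a (d - 1) ≤ Real.log ‖a i‖ := by
  rw [← logNorm_val]
  exact antitoneOn_logNorm ha h0 i.2 (Nat.sub_one_lt_of_lt i.2) (Nat.le_sub_one_of_lt i.2)

theorem sum_posLog_norm_le_neg_mul_logNorm_pred (ha : Antitone fun i => ‖a i‖)
    (h0 : ∀ i, a i ≠ 0) (hsum : ∑ i, Real.log ‖a i‖ = 0) :
    ∑ i, Real.posLog ‖a i‖ ≤ d * -logNorm a (d - 1) := by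
  have hle := logNorm_pred_le_log_norm ha h0
  have hcard (x : ℝ) : ∑ _i : Fin d, x = d * x := by simp
  have hnonpos (i : Fin d) : logNorm a (d - 1) ≤ 0 := by
    refine nonpos_of_mul_nonpos_right ?_ (Nat.cast_pos.2 i.pos : (0 : ℝ) < d)
    rw [← hcard, ← hsum]
    exact Finset.sum_le_sum fun i _ => hle i
  calc ∑ i, Real.posLog ‖a i‖ ≤ ∑ i, (Real.log ‖a i‖ - logNorm a (d - 1)) :=
        Finset.sum_le_sum fun i _ =>
          max_le (sub_nonneg.2 (hle i)) (le_sub_self_iff _ |>.2 (hnonpos i))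
    _ = d * -logNorm a (d - 1) := by rw [Finset.sum_sub_distrib, hsum, hcard]; ring

end Spread

namespace IsConjugateLabelling

variable {α : ℂ} {k d : ℕ} {a : Fin d → ℂ}

theorem sum_posLog_norm_le_mul_sub_of_card_filter_norm_eq (h : IsConjugateLabelling α a)
    (hα : IsIntegral ℤ α) (h0 : α ≠ 0) (hsum : ∑ i, Real.log ‖a i‖ = 0) {i j : Fin d}
    (hij : ‖a i‖ ≤ ‖a j‖) (hi : 2 * d < 3 * Finset.card {l | ‖a l‖ = ‖a i‖}) :
    ∑ i, Real.posLog ‖a i‖ ≤ d * (logNorm a j - logNorm a (d - 1)) := by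
  have hone : 1 ≤ ‖a i‖ := one_le_of_card_filter_norm_eq (h.prod_X_sub_C_mem_lifts hα)
    (h.injective hα) (h.ne_zero hα h0) (by rwa [Fintype.card_fin])
  have hlog : 0 ≤ logNorm a j := logNorm_val a j ▸ Real.log_nonneg (hone.trans hij)
  refine (sum_posLog_norm_le_neg_mul_logNorm_pred h.antitone_norm (h.ne_zero hα h0) hsum).trans ?_
  gcongr
  linarith

theorem logNorm_pred_lt_of_card_filter_norm_eq_le (h : IsConjugateLabelling α a)
    (hα : IsIntegral ℤ α) (h0 : α ≠ 0) {j : Fin d} (hj : 3 * (j : ℕ) < d)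
    (hcard : 3 * Finset.card {l | ‖a l‖ = ‖a j‖} ≤ 2 * d) : logNorm a (d - 1) < logNorm a j := by
  have hne := h.ne_zero hα h0
  obtain ⟨l, hl, hlj⟩ := exists_mem_ne_of_card_filter_eq_le (B := Finset.Ici j)
    (f := fun i => ‖a i‖) (by simpa using hj) (by simp) (by simpa using hcard)
  rw [logNorm_val]
  exact (logNorm_pred_le_log_norm h.antitone_norm hne l).trans_lt (Real.log_lt_log
    (norm_pos_iff.2 (hne l)) (lt_of_le_of_ne (h.antitone_norm (Finset.mem_Ici.1 hl)) hlj))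

theorem neg_log_sub_le_of_card_filter_norm_eq_le (h : IsConjugateLabelling α a)
    (hα : IsIntegral ℤ α) (h0 : α ≠ 0) (hsum : ∑ i, Real.log ‖a i‖ = 0) (hd : 3 < d) {j : Fin d}
    (hj : 3 * (j : ℕ) < d)
    (hcard : ∀ i, ‖a i‖ ≤ ‖a j‖ → 3 * Finset.card {l | ‖a l‖ = ‖a i‖} ≤ 2 * d)
    (hs : logNorm a j - logNorm a (d - 1) ≤ 1 / 2) :
    -Real.log (logNorm a j - logNorm a (d - 1)) ≤ d ^ 4 * Real.log 2 + Real.log 4 +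
      (mainExponent j d - 2 / d) * ∑ i, Real.posLog ‖a i‖ := by
  have hne := h.ne_zero hα h0
  have hpos (i : Fin d) : 0 < ‖a i‖ := norm_pos_iff.2 (hne i)
  set r := logNorm a (d - 1)
  set s := logNorm a j - r with hs_def
  have hspos : 0 < s := sub_pos.2 (h.logNorm_pred_lt_of_card_filter_norm_eq_le hα h0 hj
    (hcard j le_rfl))
  have hmem (i : Fin d) (hi : ‖a i‖ ≤ ‖a j‖) : Real.log ‖a i‖ ∈ Set.Icc r (r + s) := by
    refine ⟨logNorm_pred_le_log_norm h.antitone_norm hne i, ?_⟩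
    rw [hs_def, add_sub_cancel, logNorm_val]
    exact Real.log_le_log (hpos i) hi
  have key := h.neg_log_le_of_forall_abs_sub_le hα hd hj (ε := Real.exp (2 * r) * (4 * s))
    (by
      rw [← Fin.card_Ici]
      exact Finset.card_le_card fun i hi => by simpa using h.antitone_norm (Finset.mem_Ici.1 hi))
    hcard fun i l hi hl =>
      abs_sq_sub_sq_le_of_log_mem_Icc (hpos i) (hpos l) hs (hmem i hi) (hmem l hl)
  rw [Real.log_mul (Real.exp_pos _).ne' (by positivity), Real.log_exp,
    Real.log_mul (by norm_num) hspos.ne'] at key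
  have hX : 2 / d * ∑ i, Real.posLog ‖a i‖ ≤ 2 * -r := by
    have := sum_posLog_norm_le_neg_mul_logNorm_pred h.antitone_norm hne hsum
    rw [div_mul_eq_mul_div, div_le_iff₀ (by positivity)]
    linarith
  linarith

theorem exp_neg_mul_rpow_le_sub (h : IsConjugateLabelling α a)
    (hα : IsIntegral ℤ α) (h0 : α ≠ 0) (hdeg : (minpoly ℚ α).natDegree = d)
    (hsum : ∑ i, Real.log ‖a i‖ = 0) (hd : 3 < d) {j : Fin d} (hj : 3 * (j : ℕ) < d)
    (hcard : ∀ i, ‖a i‖ ≤ ‖a j‖ → 3 * Finset.card {l | ‖a l‖ = ‖a i‖} ≤ 2 * d)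
    (hs : logNorm a j - logNorm a (d - 1) ≤ 1 / 2) :
    Real.exp (-(d ^ 4 * Real.log 2 + Real.log 4 + 2 * d ^ 3 * Real.log √(d + 1))) *
      (polyHeight (minpoly ℤ α) : ℝ) ^ (-mainExponent j d + 2 / d) ≤
        logNorm a j - logNorm a (d - 1) := by
  have hdR : (4 : ℝ) ≤ d := by exact_mod_cast hd
  have hH : (0 : ℝ) < polyHeight (minpoly ℤ α) := by
    exact_mod_cast one_le_polyHeight_of_monic (minpoly.monic hα)
  have hspos := sub_pos.2 (h.logNorm_pred_lt_of_card_filter_norm_eq_le hα h0 hj (hcard j le_rfl))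
  have hE : 0 ≤ mainExponent j d - 2 / d := by
    have : 2 / (d : ℝ) ≤ 1 := by rw [div_le_one (by linarith)]; linarith
    linarith [two_le_mainExponent (k := j) hd]
  have hE' : mainExponent j d - 2 / d ≤ 2 * d ^ 3 := by
    have : 0 ≤ 2 / (d : ℝ) := by positivity
    linarith [mainExponent_le hj]
  have hκ : 0 ≤ Real.log √(d + 1) := Real.log_nonneg (Real.one_le_sqrt.2 (by linarith))
  have hlog := h.neg_log_sub_le_of_card_filter_norm_eq_le hα h0 hsum hd hj hcard hs
  have hX := mul_le_mul_of_nonneg_left (h.sum_posLog_le_log_polyHeight hα hdeg) hE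
  have hκE := mul_le_mul_of_nonneg_right hE' hκ
  rw [Real.rpow_def_of_pos hH, ← Real.exp_add, ← Real.le_log_iff_exp_le hspos]
  linarith

theorem exists_pos_mul_rpow_le_sum_log_norm_add_sub {d : ℕ} (hd : 3 < d) :
    ∃ C : ℝ, 0 < C ∧ ∀ (α : ℂ), IsIntegral ℤ α → α ≠ 0 → (minpoly ℚ α).natDegree = d →
      (∀ n : ℕ, 0 < n → α ^ n ≠ 1) → ∀ a : Fin d → ℂ, IsConjugateLabelling α a →
        ∀ j : Fin d, 3 * (j : ℕ) < d → C * (polyHeight (minpoly ℤ α) : ℝ) ^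
          (-mainExponent j d + 2 / d) ≤
            ∑ i, Real.log ‖a i‖ + (logNorm a j - logNorm a (d - 1)) := by
  obtain ⟨δ, hδ, hgap⟩ := exists_pos_le_sum_posLog_norm d
  set K := d ^ 4 * Real.log 2 + Real.log 4 + 2 * d ^ 3 * Real.log √(d + 1)
  have hdR : (4 : ℝ) ≤ d := by exact_mod_cast hd
  obtain ⟨C, hC, hC₂, hC_half, hCδ, hCK⟩ : ∃ C : ℝ,
      0 < C ∧ C ≤ Real.log 2 ∧ C ≤ 1 / 2 ∧ C ≤ δ / d ∧ C ≤ Real.exp (-K) :=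
    ⟨min (Real.log 2) (min (1 / 2) (min (δ / d) (Real.exp (-K)))), by positivity, by simp⟩
  refine ⟨C, hC, fun α hα h0 hdeg hroot a h j hj => ?_⟩
  set P := (polyHeight (minpoly ℤ α) : ℝ) ^ (-mainExponent j d + 2 / d)
  have hP : P ≤ 1 := by
    refine Real.rpow_le_one_of_one_le_of_nonpos
      (by exact_mod_cast one_le_polyHeight_of_monic (minpoly.monic hα)) ?_
    have h2d : 2 / (d : ℝ) ≤ 1 := by rw [div_le_one (by linarith)]; linarith
    linarith [two_le_mainExponent (k := j) hd]
  have hle {x y : ℝ} (hC : C ≤ x) (hx : 0 ≤ x) (hxy : x ≤ y) : C * P ≤ y :=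
    (mul_le_mul hC hP (by positivity) hx).trans ((mul_one x).trans_le hxy)
  have hs : 0 ≤ logNorm a j - logNorm a (d - 1) := by
    rw [logNorm_val]
    exact sub_nonneg.2 (logNorm_pred_le_log_norm h.antitone_norm (h.ne_zero hα h0) j)
  rcases h.sum_log_norm_eq_zero_or_log_two_le hα h0 with hsum | hsum
  swap
  · exact hle hC₂ (by positivity) (by linarith)
  rw [hsum, zero_add]
  by_cases hcard : ∀ i, ‖a i‖ ≤ ‖a j‖ → 3 * Finset.card {l | ‖a l‖ = ‖a i‖} ≤ 2 * d
  · rcases le_or_gt (logNorm a j - logNorm a (d - 1)) (1 / 2) with hs | hs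
    · refine (mul_le_mul_of_nonneg_right hCK (by positivity)).trans ?_
      exact h.exp_neg_mul_rpow_le_sub hα h0 hdeg hsum hd hj hcard hs
    · exact hle hC_half (by norm_num) hs.le
  · push Not at hcard
    obtain ⟨i, hij, hi⟩ := hcard
    refine hle hCδ (by positivity) ?_
    rw [div_le_iff₀' (by positivity)]
    exact (hgap α hα h0 hdeg hroot a h).trans
      (h.sum_posLog_norm_le_mul_sub_of_card_filter_norm_eq hα h0 hsum hij hi)

end IsConjugateLabelling

theorem one_div_mul_sub_one_le_two_div {x y : ℝ} (hx : 1 ≤ x) (hy : 2 ≤ y) :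
    1 / (x * (y - 1)) ≤ 2 / y := by
  rw [div_le_div_iff₀ (by nlinarith) (by linarith)]
  nlinarith

theorem mainTheorem2_general {d : ℕ} (hd : 3 < d) :
    ∃ C : ℝ, 0 < C ∧
      ∀ k : ℕ, 3 * k < d → ∀ (hkd : k < d) (α : ℂ),
        IsIntegral ℤ α → (minpoly ℚ α).natDegree = d →
        (∀ n : ℕ, 0 < n → α ^ n ≠ 1) →
        ∀ a : Fin d → ℂ, IsConjugateLabelling α a →
        ∀ c ∈ exponentSet hkd,
          1 + C * (polyHeight (minpoly ℤ α) : ℝ) ^ (-mainExponent k d + 2 / d)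
            < weightedProduct hkd c a := by
  obtain ⟨C, hC, hbound⟩ := IsConjugateLabelling.exists_pos_mul_rpow_le_sum_log_norm_add_sub hd
  refine ⟨C / (d + 1), by positivity, fun k h3 hkd α hα hdeg hroot a ha c hc => ?_⟩
  have h0 : α ≠ 0 := by
    rintro rfl
    rw [minpoly.zero, natDegree_X] at hdeg
    omega
  have hne := ha.ne_zero hα h0
  have hH : (0 : ℝ) < polyHeight (minpoly ℤ α) := by
    exact_mod_cast one_le_polyHeight_of_monic (minpoly.monic hα)
  have hsum : 0 ≤ ∑ i, Real.log ‖a i‖ :=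
    (ha.sum_log_norm_eq_zero_or_log_two_le hα h0).elim Eq.ge (Real.log_pos one_lt_two).le.trans
  have hlog : C * (polyHeight (minpoly ℤ α) : ℝ) ^ (-mainExponent k d + 2 / d) ≤
      d * (weightedProduct hkd c a - 1) :=
    (hbound α hα h0 hdeg hroot a ha ⟨k, hkd⟩ h3).trans <|
      (sum_log_norm_add_sub_le hc ha.antitone_norm hne hsum).trans <|
        mul_le_mul_of_nonneg_left (Real.log_le_sub_one_of_pos (weightedProduct_pos hkd c hne))
          d.cast_nonneg
  have hW : 0 < weightedProduct hkd c a - 1 :=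
    pos_of_mul_pos_right ((by positivity : (0 : ℝ) < _).trans_le hlog) d.cast_nonneg
  rw [← lt_sub_iff_add_lt', div_mul_eq_mul_div, div_lt_iff₀ (by positivity)]
  linarith

theorem mainTheorem2 (d : ℕ) :
    ∃ C : ℝ, 0 < C ∧
      ∀ (k : ℕ) (_hk : 0 < k) (_h3 : 3 * k < d) (hkd : k < d)
        (α : ℂ), IsIntegral ℤ α → (minpoly ℚ α).natDegree = d →
        (∀ n : ℕ, 0 < n → α ^ n ≠ 1) →
        ∀ a : Fin d → ℂ, IsConjugateLabelling α a →
        ∀ c ∈ exponentSet hkd,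
          1 + C * (polyHeight (minpoly ℤ α) : ℝ) ^
              (-mainExponent k d + 1 / ((k : ℝ) * ((d : ℝ) - 1)))
            < weightedProduct hkd c a := by
  rcases le_or_gt d 3 with hd | hd
  · exact ⟨1, one_pos, fun k hk h3 => by omega⟩
  obtain ⟨C, hC, hbound⟩ := mainTheorem2_general hd
  refine ⟨C, hC, fun k hk h3 hkd α hα hdeg hroot a ha c hc =>
    lt_of_le_of_lt ?_ (hbound k h3 hkd α hα hdeg hroot a ha c hc)⟩
  have hH : (1 : ℝ) ≤ polyHeight (minpoly ℤ α) := by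
    exact_mod_cast one_le_polyHeight_of_monic (minpoly.monic hα)
  have hexp : 1 / ((k : ℝ) * (d - 1)) ≤ 2 / d :=
    one_div_mul_sub_one_le_two_div (Nat.one_le_cast.2 hk) (Nat.ofNat_le_cast.2 (by omega))
  gcongr
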